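/- Let $\eta$ be an r.e. ("positive") equivalence relation on $\mathbb N$ with infinitely many equivalence classes. An $\eta$-family is a uniformly r.e. sequence $L_0,L_1,L_2,\ldots$ of pairwise distinct subsets of $\mathbb N$, each a union of $\eta$-equivalence classes. A text for $L\subseteq\mathbb N$ is a sequence $T:\mathbb N\to\mathbb N\cup\{\#\}$ whose set of values other than $\#$ is $L$; $T[n]$ denotes $T(0),\ldots,T(n-1)$. A learner is a recursive function $M:(\mathbb N\cup\{\#\})^*\to\mathbb N\cup\{?\}$. With respect to a hypothesis space $(H_e)_{e\in\mathbb N}$ and a class $\mathcal C$ of subsets of $\mathbb N$, the learner $M$ - explanatorily learns $\mathcal C$ if for every $L\in\mathcal C$ and every text $T$ for $L$ there is $n$ with $M(T[n])\in\mathbb N$, $H_{M(T[n])}=L$ and $M(T[j])=M(T[n])$ for all $j\ge n$; - finitely learns $\mathcal C$ if, in addition, $n$ can be chosen such that $M(T[m])=\,?$ for all $m<n$; - confidently learns $\mathcal C$ if it explanatorily learns $\mathcal C$ and for every text $T$ of every subset of $\mathbb N$ there is $n$ with $M(T[j])=M(T[n])$ for all $j\ge n$. An $\eta$-family $(L_i)_{i\in\mathbb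 N}$ is exactly learnable under a criterion if some learner learns $\{L_i:i\in\mathbb N\}$ under this criterion with respect to the hypothesis space $(L_i)_{i\in\mathbb N}$ itself. An $\eta$-family $(K_i)$ is a strong union of $\eta$-families $(L_i)$ and $(H_i)$ if $\{K_i\}=\{L_i\}\cup\{H_i\}$ and there are one-one recursive functions $f,g$ with $L_i=K_{f(i)}$ and $H_i=K_{g(i)}$ for all $i$. A criterion is strongly closed under union with respect to $\eta$ if every strong union of two $\eta$-families that are exactly learnable under it is again exactly learnable under it. Theorem. For every positive equivalence relation $\eta$ with infinitely many equivalence classes: 1. confident learning is strongly closed under union with respect to $\eta$; 2. explanatory learning is not strongly closed under union with respect to $\eta$; 3. if there is at least one $\eta$-family that is finitely learnable (with respect to the hypothesis space of the $\eta$-closures of $W_0,W_1,\ldots$, where $W_e$ is the domain of the $e$-th partial recursive function in an acceptable numbering), then finite learning is not strongly closed under union with respect to $\eta$. -/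

import Mathlib

namespace PosLearn

/-- A positive (recursively enumerable) equivalence relation on `ℕ`
with infinitely many equivalence classes. -/
structure IsPositive (η : Setoid ℕ) : Prop where
  re : REPred fun p : ℕ × ℕ => η p.1 p.2
  infinite : Infinite (Quotient η)

/-- A set is `η`-closed if it is a union of `η`-equivalence classes. -/
def EtaClosed (η : Setoid ℕ) (A : Set ℕ) : Prop :=
  ∀ x y, η x y → x ∈ A → y ∈ A

/-- The `η`-closure `[A]` of a set. -/
def etaClosure (η : Setoid ℕ) (A : Set ℕ) : Set ℕ := {x | ∃ y ∈ A, η y x}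

/-- `L 0, L 1, …` is (a one-one indexing of) an `η`-family: a uniformly r.e. sequence of
pairwise distinct `η`-closed sets. -/
structure IsFamily (η : Setoid ℕ) (L : ℕ → Set ℕ) : Prop where
  re : REPred fun p : ℕ × ℕ => p.2 ∈ L p.1
  injective : Function.Injective L
  closed : ∀ i, EtaClosed η (L i)

/-- A text: a sequence of numbers and pause symbols (`none` is the pause `#`). -/
abbrev Text := ℕ → Option ℕ

/-- The content of a text. -/
def Text.content (T : Text) : Set ℕ := {x | ∃ n, T n = some x}

/-- The initial segment `T(0), …, T(n-1)`. -/
def Text.initial (T : Text) (n : ℕ) : List (Option ℕ) := (List.range n).map T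

/-- The type of learners; `none` as an output is the symbol `?`.
Recursiveness is required separately, in `Learnable`. -/
abbrev Learner := List (Option ℕ) → Option ℕ

/-- A learning criterion relates a learner, a hypothesis space `W 0, W 1, …`,
and a class of languages. -/
abbrev Criterion := Learner → (ℕ → Set ℕ) → Set (Set ℕ) → Prop

/-- Explanatory learning: on every text for a language of the class the learner converges
to a single correct index. -/
def ExLearns : Criterion := fun M W C =>
  ∀ A ∈ C, ∀ T : Text, T.content = A →
    ∃ n e, M (T.initial n) = some e ∧ W e = A ∧
      ∀ j, n ≤ j → M (T.initial j) = M (T.initial n)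

/-- Confident learning: explanatory learning by a learner that converges on every text. -/
def ConfLearns : Criterion := fun M W C =>
  ExLearns M W C ∧
    ∀ T : Text, ∃ n, ∀ j, n ≤ j → M (T.initial j) = M (T.initial n)

/-- Finite (one-shot) learning: on every text for a language of the class the first
output other than `?` is a correct index and is kept forever. -/
def FinLearns : Criterion := fun M W C =>
  ∀ A ∈ C, ∀ T : Text, T.content = A →
    ∃ n e, M (T.initial n) = some e ∧ W e = A ∧
      (∀ m, m < n → M (T.initial m) = none) ∧
      ∀ j, n ≤ j → M (T.initial j) = M (T.initial n)

/-- The class `C` has a recursive `I`-learner with respect to the hypothesis space `W`. -/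
def Learnable (I : Criterion) (W : ℕ → Set ℕ) (C : Set (Set ℕ)) : Prop :=
  ∃ M : Learner, Computable M ∧ I M W C

/-- Exact learning: the family itself is the hypothesis space. -/
def ExactlyLearnable (I : Criterion) (L : ℕ → Set ℕ) : Prop :=
  Learnable I L (Set.range L)

/-- The default hypothesis space: the `η`-closures of the domains of the partial recursive
functions in an acceptable numbering. -/
def closedW (η : Setoid ℕ) (e : ℕ) : Set ℕ :=
  etaClosure η {x | ((Denumerable.ofNat Nat.Partrec.Code e).eval x).Dom}

/-- One-one reducibility between indexed families. -/
def OneOneReducible (L H : ℕ → Set ℕ) : Prop :=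
  ∃ f : ℕ → ℕ, Computable f ∧ Function.Injective f ∧ ∀ e, L e = H (f e)

/-- The `η`-family `K` is a strong union of `L` and `H`. -/
structure IsStrongUnion (η : Setoid ℕ) (L H K : ℕ → Set ℕ) : Prop where
  family : IsFamily η K
  union : Set.range K = Set.range L ∪ Set.range H
  left : OneOneReducible L K
  right : OneOneReducible H K

/-- `I` is strongly closed under union with respect to `η`: every strong union of two exactly
`I`-learnable `η`-families is exactly `I`-learnable. -/
def StronglyClosedUnderUnion (I : Criterion) (η : Setoid ℕ) : Prop :=
  ∀ L H K : ℕ → Set ℕ, IsFamily η L → IsFamily η H →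
    ExactlyLearnable I L → ExactlyLearnable I H →
    IsStrongUnion η L H K → ExactlyLearnable I K

end PosLearn

/-! Confident learning: on every text both learners converge, so in the limit there are at most two
candidates in the one-one family `K`. If their indices differ, so do the sets, and the least point
of difference can be found in the limit; whether the text contains that point decides between them
(`eventually_selectIndex`).

Explanatory learning: the counterexamples are built from `chain η e`, the increasing unions of the
first classes met by an enumeration `e`, which are learned by locating the first gap
(`eventually_chainGuess`). Write `[x]` for the class of `x`. If some r.e. closed `U` meets
infinitely many classes and misses a point `a`, one family consists of the chain through `U` with
`[a]` adjoined, the other of the bare chain and `U ∪ [a]`. Each is learnable, but together they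
contain an increasing sequence and its limit, against Gold's criterion (`not_exLearns_of_limit`). If
there is no such `U`, one family contains the sets `[0] ∪ [y]` and the other contains `[0]`, both
filled up with chain members. A learner for the union has a locking sequence `σ` for `[0]`. The `y`
for which it changes its mind after `σ` inside `[0] ∪ [y]` form an r.e. closed set omitting `0`,
which therefore has only finitely many classes; for a `y` beyond them the learner confuses `[0] ∪
[y]` with `[0]`.

Finite learning: the data seen at the first proper output give computable finite samples `G i`, none
contained in the closure of another (`exists_samples`). The closures of `G 0` and of `G 0 ++ G 1` go
into different families, both completed by the same tail of closures of samples. Each family still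
has characteristic samples, yet the union contains a set and a proper superset of it, which no
finite learner can handle. -/

namespace PosLearn

open Filter Encodable

/-! ### Closure properties of recursive and r.e. predicates, and stage approximations. -/

section Recursion

variable {α β γ : Type*} [Primcodable α] [Primcodable β] [Primcodable γ]

theorem computablePred_comp {p : β → Prop} {f : α → β} (hp : ComputablePred p)
    (hf : Computable f) : ComputablePred fun a => p (f a) := by
  classical
  exact Computable.computablePred (hp.decide.comp hf)

theorem computablePred_and {p q : α → Prop} (hp : ComputablePred p) (hq : ComputablePred q) :
    ComputablePred fun a => p a ∧ q a := by
  classical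
  refine Computable.computablePred ((Primrec.and.to_comp.comp hp.decide hq.decide).of_eq ?_)
  intro a
  simp

theorem computablePred_or {p q : α → Prop} (hp : ComputablePred p) (hq : ComputablePred q) :
    ComputablePred fun a => p a ∨ q a := by
  classical
  refine Computable.computablePred ((Primrec.or.to_comp.comp hp.decide hq.decide).of_eq ?_)
  intro a
  simp

theorem computable_ite {p : α → Prop} [DecidablePred p] {f g : α → β} (hp : ComputablePred p)
    (hf : Computable f) (hg : Computable g) : Computable fun a => if p a then f a else g a := by
  refine (Computable.cond hp.decide hf hg).of_eq fun a => ?_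
  by_cases h : p a <;> simp [h]

/-- `D` is a primitive recursive increasing approximation of the r.e. predicate `p`. -/
structure IsStaged (p : α → Prop) (D : ℕ → α → Prop) : Prop where
  prim : PrimrecPred fun q : ℕ × α => D q.1 q.2
  mono : ∀ {a s t}, s ≤ t → D s a → D t a
  iff : ∀ a, p a ↔ ∃ s, D s a

theorem IsStaged.sound {p : α → Prop} {D : ℕ → α → Prop} (h : IsStaged p D) {s : ℕ} {a : α}
    (ha : D s a) : p a := (h.iff a).2 ⟨s, ha⟩

theorem IsStaged.eventually {p : α → Prop} {D : ℕ → α → Prop} (h : IsStaged p D) (a : α) :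
    ∀ᶠ s in atTop, (D s a ↔ p a) := by
  by_cases ha : p a
  · obtain ⟨s, hs⟩ := (h.iff a).1 ha
    filter_upwards [eventually_ge_atTop s] with t ht
    exact ⟨fun _ => ha, fun _ => h.mono ht hs⟩
  · exact Eventually.of_forall fun s => ⟨h.sound, fun h' => absurd h' ha⟩

/-- Stage `s` runs a code for `p` with the bounded evaluator `evaln s`, which is primitive
recursive, monotone in the bound, and finds every halting computation. -/
theorem exists_staged {p : α → Prop} (hp : REPred p) : ∃ D, IsStaged p D := by
  obtain ⟨c, hc⟩ := Nat.Partrec.Code.exists_code.1 hp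
  refine ⟨fun s a => (Nat.Partrec.Code.evaln s c (encode a)).isSome = true, ?_, ?_, ?_⟩
  · refine Primrec.eq.comp (Primrec.option_isSome.comp ?_) (Primrec.const true)
    exact Nat.Partrec.Code.primrec_evaln.comp
      ((Primrec.fst.pair (Primrec.const c)).pair (Primrec.encode.comp Primrec.snd))
  · intro a s t hst h
    obtain ⟨x, hx⟩ := Option.isSome_iff_exists.1 h
    exact Option.isSome_iff_exists.2 ⟨x, Nat.Partrec.Code.evaln_mono hst hx⟩
  · intro a
    have key : p a ↔ (c.eval (encode a)).Dom := by
      rw [hc]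
      simp [Part.assert, Part.bind]
    rw [key, Part.dom_iff_mem]
    constructor
    · rintro ⟨y, hy⟩
      obtain ⟨k, hk⟩ := Nat.Partrec.Code.evaln_complete.1 hy
      exact ⟨k, Option.isSome_iff_exists.2 ⟨y, hk⟩⟩
    · rintro ⟨k, hk⟩
      obtain ⟨x, hx⟩ := Option.isSome_iff_exists.1 hk
      exact ⟨x, Nat.Partrec.Code.evaln_sound hx⟩

theorem re_exists_nat {R : α → ℕ → Prop} (h : ComputablePred fun q : α × ℕ => R q.1 q.2) :
    REPred fun a => ∃ n, R a n := by
  classical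
  have h1 : Partrec fun a => Nat.rfind fun n => Part.some (decide (R a n)) :=
    Partrec.rfind h.decide.partrec
  refine h1.dom_re.of_eq fun a => ?_
  refine Nat.rfind_dom.trans ?_
  constructor
  · rintro ⟨n, hn, -⟩
    exact ⟨n, by simpa using hn⟩
  · rintro ⟨n, hn⟩
    exact ⟨n, by simpa using hn, fun _ => trivial⟩

theorem re_exists_of_computable {R : α → β → Prop}
    (h : ComputablePred fun q : α × β => R q.1 q.2) : REPred fun a => ∃ b, R a b := by
  classical
  have h1 : ComputablePred fun q : α × ℕ => ∃ b ∈ (decode q.2 : Option β), R q.1 b := by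
    refine Computable.computablePred ?_
    have := Computable.option_casesOn (o := fun q : α × ℕ => (decode q.2 : Option β))
      (f := fun _ => false) (g := fun q b => decide (R q.1 b))
      (Computable.decode.comp Computable.snd) (Computable.const false)
      (h.decide.comp ((Computable.fst.comp Computable.fst).pair Computable.snd)).to₂
    refine this.of_eq fun q => ?_
    cases hq : (decode q.2 : Option β) <;> simp
  refine (re_exists_nat (R := fun a n => ∃ b ∈ (decode n : Option β), R a b) h1).of_eq fun a => ?_
  constructor
  · rintro ⟨n, b, -, hb⟩
    exact ⟨b, hb⟩
  · rintro ⟨b, hb⟩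
    exact ⟨encode b, b, by simp, hb⟩

theorem re_comp {p : β → Prop} {f : α → β} (hp : REPred p) (hf : Computable f) :
    REPred fun a => p (f a) :=
  Partrec.comp hp hf

/-- Dovetailing: search for a witness together with a stage that confirms it. -/
theorem re_exists {R : α → β → Prop} (h : REPred fun q : α × β => R q.1 q.2) :
    REPred fun a => ∃ b, R a b := by
  obtain ⟨D, hD⟩ := exists_staged h
  refine (re_exists_of_computable (R := fun a (q : β × ℕ) => D q.2 (a, q.1)) ?_).of_eq fun a => ?_
  · refine computablePred_comp hD.prim.computablePred (f := fun q : α × β × ℕ =>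
      (q.2.2, (q.1, q.2.1))) ?_
    exact (Computable.snd.comp Computable.snd).pair
      (Computable.fst.pair (Computable.fst.comp Computable.snd))
  · constructor
    · rintro ⟨⟨b, s⟩, h⟩
      exact ⟨b, hD.sound h⟩
    · rintro ⟨b, hb⟩
      obtain ⟨s, hs⟩ := (hD.iff (a, b)).1 hb
      exact ⟨(b, s), hs⟩

theorem re_and {p q : α → Prop} (hp : REPred p) (hq : REPred q) :
    REPred fun a => p a ∧ q a := by
  obtain ⟨D, hD⟩ := exists_staged hp
  obtain ⟨E, hE⟩ := exists_staged hq
  have hs : Computable fun x : α × ℕ => (x.2, x.1) := Computable.snd.pair Computable.fst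
  refine (re_exists_nat (R := fun a s => D s a ∧ E s a) (computablePred_and (computablePred_comp hD.prim.computablePred hs)
    (computablePred_comp hE.prim.computablePred hs))).of_eq fun a => ?_
  constructor
  · rintro ⟨s, h1, h2⟩
    exact ⟨hD.sound h1, hE.sound h2⟩
  · rintro ⟨h1, h2⟩
    obtain ⟨s, hs⟩ := (hD.iff a).1 h1
    obtain ⟨t, ht⟩ := (hE.iff a).1 h2
    exact ⟨max s t, hD.mono (le_max_left _ _) hs, hE.mono (le_max_right _ _) ht⟩

theorem re_or {p q : α → Prop} (hp : REPred p) (hq : REPred q) :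
    REPred fun a => p a ∨ q a := by
  obtain ⟨D, hD⟩ := exists_staged hp
  obtain ⟨E, hE⟩ := exists_staged hq
  have hs : Computable fun x : α × ℕ => (x.2, x.1) := Computable.snd.pair Computable.fst
  refine (re_exists_nat (R := fun a s => D s a ∨ E s a) (computablePred_or (computablePred_comp hD.prim.computablePred hs)
    (computablePred_comp hE.prim.computablePred hs))).of_eq fun a => ?_
  simp only [hD.iff a, hE.iff a, exists_or]

/-- Since the list is finite and stages increase, one stage confirms all its members at once. -/
theorem re_forall_mem_list {R : α → β → Prop} (h : REPred fun q : β × α => R q.2 q.1) :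
    REPred fun q : α × List β => ∀ b ∈ q.2, R q.1 b := by
  obtain ⟨D, hD⟩ := exists_staged h
  have h1 : PrimrecRel fun (b : β) (x : ℕ × α) => D x.1 (b, x.2) :=
    hD.prim.comp ((Primrec.fst.comp Primrec.snd).pair
      (Primrec.fst.pair (Primrec.snd.comp Primrec.snd)))
  have h2 : PrimrecRel fun (l : List β) (x : ℕ × α) => ∀ b ∈ l, D x.1 (b, x.2) := h1.forall_mem_list
  have h3 : PrimrecPred fun q : (α × List β) × ℕ => ∀ b ∈ q.1.2, D q.2 (b, q.1.1) :=
    h2.comp (Primrec.snd.comp Primrec.fst) (Primrec.snd.pair (Primrec.fst.comp Primrec.fst))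
  refine (re_exists_nat (R := fun (q : α × List β) s => ∀ b ∈ q.2, D s (b, q.1))
    h3.computablePred).of_eq ?_
  rintro ⟨a, l⟩
  constructor
  · rintro ⟨s, hs⟩ b hb
    exact hD.sound (hs b hb)
  · intro hl
    have hev : ∀ᶠ s in atTop, ∀ b ∈ l, D s (b, a) := by
      have := (List.finite_toSet l).eventually_all (l := atTop)
        (p := fun b s => D s (b, a))
      refine this.2 fun b hb => ?_
      filter_upwards [hD.eventually (b, a)] with s hs
      exact hs.2 (hl b hb)
    exact hev.exists

end Recursion

/-- The convergence argument for the limiting least-number searches below: only the finitely many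
candidates under `z` have to be rejected for good. -/
theorem eventually_find_eq {P : ℕ → ℕ → Prop} [∀ n, DecidablePred (P n)] (h : ∀ n, ∃ i, P n i)
    {z : ℕ} (hz : ∀ᶠ n in atTop, P n z) (hlt : ∀ i < z, ∀ᶠ n in atTop, ¬ P n i) :
    ∀ᶠ n in atTop, Nat.find (h n) = z := by
  have hlt' : ∀ᶠ n in atTop, ∀ i ∈ Set.Iio z, ¬ P n i :=
    ((Set.finite_Iio z).eventually_all).2 hlt
  filter_upwards [hz, hlt'] with n h1 h2
  exact (Nat.find_eq_iff (h n)).2 ⟨h1, fun m hm => h2 m hm⟩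

/-! ### Texts and their finite initial segments. -/

section Texts

/-- The finite sequence `σ` contains only elements of `A` (and pauses). -/
def SeqIn (σ : List (Option ℕ)) (A : Set ℕ) : Prop := ∀ x, some x ∈ σ → x ∈ A

theorem SeqIn.mono {σ : List (Option ℕ)} {A B : Set ℕ} (h : SeqIn σ A) (hAB : A ⊆ B) :
    SeqIn σ B := fun x hx => hAB (h x hx)

theorem SeqIn.append {σ τ : List (Option ℕ)} {A : Set ℕ} (h : SeqIn σ A) (h' : SeqIn τ A) :
    SeqIn (σ ++ τ) A := fun x hx => (List.mem_append.1 hx).elim (h x) (h' x)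

@[simp] theorem Text.length_initial (T : Text) (n : ℕ) : (T.initial n).length = n := by
  simp [Text.initial]

theorem Text.mem_initial {T : Text} {n : ℕ} {o : Option ℕ} :
    o ∈ T.initial n ↔ ∃ i < n, T i = o := by
  simp [Text.initial]

theorem Text.initial_add (T : Text) (n m : ℕ) :
    T.initial (n + m) = T.initial n ++ (List.range m).map fun i => T (n + i) := by
  simp [Text.initial, List.range_add, Function.comp_def]

theorem Text.seqIn_initial (T : Text) (n : ℕ) : SeqIn (T.initial n) T.content := by
  intro x hx
  obtain ⟨i, -, hi⟩ := Text.mem_initial.1 hx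
  exact ⟨i, hi⟩

theorem Text.eventually_mem (T : Text) (x : ℕ) :
    ∀ᶠ n in atTop, (some x ∈ T.initial n ↔ x ∈ T.content) := by
  by_cases hx : x ∈ T.content
  · obtain ⟨i, hi⟩ := hx
    filter_upwards [eventually_gt_atTop i] with n hn
    exact ⟨fun _ => ⟨i, hi⟩, fun _ => Text.mem_initial.2 ⟨i, hn, hi⟩⟩
  · exact Eventually.of_forall fun n => ⟨fun h => T.seqIn_initial n x h, fun h => absurd h hx⟩

open Classical in
/-- The canonical text listing a set in increasing order. -/
noncomputable def canonText (A : Set ℕ) : Text := fun n => if n ∈ A then some n else none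

theorem content_canonText (A : Set ℕ) : (canonText A).content = A := by
  ext x
  constructor
  · rintro ⟨n, hn⟩
    unfold canonText at hn
    split_ifs at hn with h
    cases hn
    exact h
  · intro hx
    exact ⟨x, by simp [canonText, hx]⟩

/-- The text `T` preceded by the finite sequence `σ`. -/
def prependText (σ : List (Option ℕ)) (T : Text) : Text :=
  fun n => (σ[n]?).getD (T (n - σ.length))

theorem initial_prependText (σ : List (Option ℕ)) (T : Text) (n : ℕ) :
    (prependText σ T).initial (σ.length + n) = σ ++ T.initial n := by
  rw [Text.initial_add]
  congr 1
  · apply List.ext_getElem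
    · simp
    · intro i h1 h2
      simp [Text.initial, prependText, h2]
  · simp [Text.initial, prependText]

theorem content_prependText (σ : List (Option ℕ)) (T : Text) (h : SeqIn σ T.content) :
    (prependText σ T).content = T.content := by
  ext x
  constructor
  · rintro ⟨n, hn⟩
    unfold prependText at hn
    by_cases hl : n < σ.length
    · rw [List.getElem?_eq_getElem hl] at hn
      apply h
      rw [← hn]
      simp
    · rw [List.getElem?_eq_none (not_lt.1 hl)] at hn
      exact ⟨_, hn⟩
  · rintro ⟨n, hn⟩
    refine ⟨σ.length + n, ?_⟩
    simp [prependText, hn]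

theorem prefix_of_chain {S : ℕ → List (Option ℕ)} (hS : ∀ n, S n <+: S (n + 1)) {n m : ℕ}
    (h : n ≤ m) : S n <+: S m := by
  induction m, h using Nat.le_induction with
  | base => exact List.prefix_rfl
  | succ k _ ih => exact ih.trans (hS k)

/-- An increasing chain of finite sequences of unbounded length converges to a text. -/
theorem exists_limit_text {S : ℕ → List (Option ℕ)} (hS : ∀ n, S n <+: S (n + 1))
    (hlen : ∀ n, n ≤ (S n).length) : ∃ T : Text, ∀ n, T.initial (S n).length = S n := by
  refine ⟨fun i => ((S (i + 1))[i]?).getD none, fun n => ?_⟩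
  apply List.ext_getElem
  · simp
  · intro i h1 h2
    have h3 : i < (S (i + 1)).length := hlen (i + 1)
    have : (S (i + 1))[i] = (S n)[i] := by
      rcases le_total (i + 1) n with h | h
      · exact (prefix_of_chain hS h).getElem h3
      · exact ((prefix_of_chain hS h).getElem h2).symm
    simp [Text.initial, List.getElem?_eq_getElem h3, this]

end Texts

/-! ### Locking sequences and Gold's criterion. -/

section Locking

variable {M : Learner} {W : ℕ → Set ℕ} {C : Set (Set ℕ)}

theorem exLearns_of_eventually (h : ∀ A ∈ C, ∀ T : Text, T.content = A →
    ∃ e, W e = A ∧ ∀ᶠ n in atTop, M (T.initial n) = some e) : ExLearns M W C := by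
  intro A hA T hT
  obtain ⟨e, he, hev⟩ := h A hA T hT
  obtain ⟨n, hn⟩ := eventually_atTop.1 hev
  exact ⟨n, e, hn n le_rfl, he, fun j hj => (hn j hj).trans (hn n le_rfl).symm⟩

theorem ExLearns.eventually (h : ExLearns M W C) {A : Set ℕ} (hA : A ∈ C) {T : Text}
    (hT : T.content = A) : ∃ e, W e = A ∧ ∀ᶠ n in atTop, M (T.initial n) = some e := by
  obtain ⟨n, e, hn, he, hj⟩ := h A hA T hT
  exact ⟨e, he, eventually_atTop.2 ⟨n, fun j h => (hj j h).trans hn⟩⟩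

/-- If `M` makes no mind change on extensions of `σ` inside `A`, then `M σ` is correct for `A`. -/
theorem ExLearns.correct_of_locked (h : ExLearns M W C) {A : Set ℕ} (hA : A ∈ C)
    {σ : List (Option ℕ)} (hσ : SeqIn σ A) (hl : ∀ τ, SeqIn τ A → M (σ ++ τ) = M σ) :
    ∃ e, M σ = some e ∧ W e = A := by
  obtain ⟨e, he, hev⟩ := h.eventually hA (T := prependText σ (canonText A))
    ((content_prependText _ _ (by rwa [content_canonText])).trans (content_canonText A))
  obtain ⟨n, hn⟩ := eventually_atTop.1 hev
  refine ⟨e, ?_, he⟩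
  rw [← hl ((canonText A).initial n), ← initial_prependText, hn _ (by omega)]
  have := (canonText A).seqIn_initial n
  rwa [content_canonText] at this

/-- Otherwise every sequence in `A` has an extension in `A` with a mind change, and iterating this
while also listing `A` produces a text for `A` on which `M` does not converge. -/
theorem ExLearns.exists_locked (h : ExLearns M W C) {A : Set ℕ} (hA : A ∈ C) :
    ∃ σ, SeqIn σ A ∧ ∀ τ, SeqIn τ A → M (σ ++ τ) = M σ := by
  by_contra hcon
  push Not at hcon
  have hex : ∀ σ, ∃ τ, SeqIn τ A ∧ (SeqIn σ A → M (σ ++ τ) ≠ M σ) := by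
    intro σ
    by_cases hσ : SeqIn σ A
    · obtain ⟨τ, h1, h2⟩ := hcon σ hσ
      exact ⟨τ, h1, fun _ => h2⟩
    · exact ⟨[], by simp [SeqIn], fun h => absurd h hσ⟩
  choose τ hτ1 hτ2 using hex
  -- Each round appends one term of the canonical text, so that the limit lists all of `A`, and then
  -- an extension provoking a mind change.
  let S : ℕ → List (Option ℕ) := fun n => Nat.rec []
    (fun n σ => (σ ++ [canonText A n]) ++ τ (σ ++ [canonText A n])) n
  have hS0 : S 0 = [] := rfl
  have hS1 : ∀ n, S (n + 1) = (S n ++ [canonText A n]) ++ τ (S n ++ [canonText A n]) :=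
    fun _ => rfl
  have hcan : ∀ n, SeqIn [canonText A n] A := by
    intro n x hx
    rw [List.mem_singleton] at hx
    rw [← content_canonText A]
    exact ⟨n, hx.symm⟩
  have hSin : ∀ n, SeqIn (S n) A := by
    intro n
    induction n with
    | zero => intro x hx; rw [hS0] at hx; cases hx
    | succ k ih => rw [hS1]; exact (ih.append (hcan k)).append (hτ1 _)
  have hpre : ∀ n, S n <+: S (n + 1) := by
    intro n
    rw [hS1, List.append_assoc]
    exact List.prefix_append _ _
  have hlen : ∀ n, n ≤ (S n).length := by
    intro n
    induction n with
    | zero => omega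
    | succ k ih => rw [hS1]; simp; omega
  obtain ⟨T, hT⟩ := exists_limit_text hpre hlen
  have hTc : T.content = A := by
    ext x
    constructor
    · rintro ⟨n, hn⟩
      apply hSin (n + 1)
      rw [← hT (n + 1)]
      exact Text.mem_initial.2 ⟨n, hlen (n + 1), hn⟩
    · intro hx
      have h1 : some x ∈ S (x + 1) := by
        rw [hS1]
        simp [canonText, hx]
      rw [← hT (x + 1)] at h1
      exact T.seqIn_initial _ x h1
  obtain ⟨e, -, hev⟩ := h.eventually hA hTc
  obtain ⟨n, hn⟩ := eventually_atTop.1 hev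
  have hmid : T.initial ((S n).length + 1) = S n ++ [canonText A n] := by
    have h1 := hT (n + 1)
    rw [hS1, List.length_append, Text.initial_add] at h1
    have h2 := (List.append_inj h1 (by simp)).1
    simpa using h2
  apply hτ2 (S n ++ [canonText A n]) ((hSin n).append (hcan n))
  -- Both sides are values of `M` on initial segments of `T` of length at least `n`, where `M` has
  -- already converged.
  rw [← hmid, hn _ (by have := hlen n; omega), hmid, ← hS1, ← hT (n + 1), hn]
  exact (Nat.le_succ n).trans (hlen (n + 1))

/-- Gold's criterion: a class containing a set `A` together with proper subsets of `A` covering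
any finite part of `A` is not explanatorily learnable. -/
theorem not_exLearns_of_limit {A : Set ℕ} (hA : A ∈ C)
    (hsub : ∀ σ, SeqIn σ A → ∃ B ∈ C, SeqIn σ B ∧ B ⊆ A ∧ B ≠ A) : ¬ ExLearns M W C := by
  intro h
  obtain ⟨σ, hσ, hl⟩ := h.exists_locked hA
  obtain ⟨e, he, hWe⟩ := h.correct_of_locked hA hσ hl
  -- A sequence locking `M` on `A` also locks it on any subset `B` that contains the sequence, so
  -- `M` gives one index for both sets.
  obtain ⟨B, hB, hσB, hBA, hne⟩ := hsub σ hσ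
  obtain ⟨e', he', hWe'⟩ := h.correct_of_locked hB hσB fun τ hτ => hl τ (hτ.mono hBA)
  rw [he] at he'
  cases he'
  exact hne (hWe'.symm.trans hWe)

end Locking

/-! ### The increasing chain of finite unions of classes, and its learner. -/

section Chain

variable (η : Setoid ℕ) (E : ℕ → ℕ × ℕ → Prop) (e : ℕ → ℕ)

/-- `e j` is the first element of its class in the enumeration `e`. -/
def IsNew (j : ℕ) : Prop := ∀ i < j, ¬ η (e i) (e j)

/-- `E s`-approximation to `IsNew`. -/
def StageNew (s j : ℕ) : Prop := ∀ i < j, ¬ E s (e i, e j)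

open Classical in
/-- The number of classes met by `e 0, …, e (i-1)`. -/
noncomputable def rank (i : ℕ) : ℕ := Nat.count (IsNew η e) i

open Classical in
/-- The stage `s` approximation, from above, to `rank`. -/
noncomputable def stageRank (s i : ℕ) : ℕ := Nat.count (StageNew E e s) i

/-- The union of the first `k + 1` classes in the order in which `e` meets them. -/
def chain (k : ℕ) : Set ℕ := {x | ∃ i, η (e i) x ∧ rank η e i ≤ k}

/-- The least index `i` below the length of `σ` such that `e i` is missing in `σ`
(the length itself if there is none). -/
noncomputable def firstMissing (σ : List (Option ℕ)) : ℕ :=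
  open Classical in Nat.find (p := fun i => σ.length ≤ i ∨ some (e i) ∉ σ) ⟨σ.length, Or.inl le_rfl⟩

/-- The learner for `chain η e`. -/
noncomputable def chainGuess (σ : List (Option ℕ)) : ℕ :=
  stageRank E e σ.length (firstMissing e σ) - 1

variable {η E e}

theorem rank_mono : Monotone (rank η e) := by
  classical
  exact Nat.count_monotone _

theorem rank_le (i : ℕ) : rank η e i ≤ i := by
  classical
  exact Nat.count_le _

theorem exists_isNew (i : ℕ) : ∃ j ≤ i, IsNew η e j ∧ η (e j) (e i) := by
  classical
  have h : ∃ j, η (e j) (e i) := ⟨i, η.refl _⟩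
  exact ⟨Nat.find h, Nat.find_min' h (η.refl _), fun k hk hk' =>
    Nat.find_min h hk (η.trans hk' (Nat.find_spec h)), Nat.find_spec h⟩

theorem infinite_isNew (hinf : (Set.range fun i => Quotient.mk η (e i)).Infinite) :
    {j | IsNew η e j}.Infinite := by
  intro hfin
  apply hinf
  refine (hfin.image fun i => Quotient.mk η (e i)).subset ?_
  rintro _ ⟨i, rfl⟩
  obtain ⟨j, -, hj, hji⟩ := exists_isNew (η := η) (e := e) i
  exact ⟨j, hj, Quotient.sound hji⟩

/-- A new index is the least index of its class, hence has the least rank there. -/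
theorem IsNew.mem_chain_iff {j k : ℕ} (hj : IsNew η e j) :
    e j ∈ chain η e k ↔ rank η e j ≤ k := by
  constructor
  · rintro ⟨i, hi, hik⟩
    refine le_trans (rank_mono ?_) hik
    by_contra hlt
    exact hj i (not_le.1 hlt) hi
  · intro h
    exact ⟨j, η.refl _, h⟩

theorem mem_chain_of_le {i k : ℕ} (h : i ≤ k) : e i ∈ chain η e k :=
  ⟨i, η.refl _, (rank_le i).trans h⟩

theorem chain_mono : Monotone (chain η e) :=
  fun _ _ hkl _ ⟨i, hi, hik⟩ => ⟨i, hi, hik.trans hkl⟩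

theorem etaClosed_chain (k : ℕ) : EtaClosed η (chain η e k) :=
  fun _ _ hxy ⟨i, hi, hik⟩ => ⟨i, η.trans hi hxy, hik⟩

theorem chain_subset {A : Set ℕ} (hA : EtaClosed η A) (he : ∀ i, e i ∈ A) (k : ℕ) :
    chain η e k ⊆ A := fun _ ⟨i, hi, _⟩ => hA _ _ hi (he i)

theorem exists_rank_eq (hinf : (Set.range fun i => Quotient.mk η (e i)).Infinite) (k : ℕ) :
    ∃ j, IsNew η e j ∧ rank η e j = k := by
  classical
  exact ⟨Nat.nth (IsNew η e) k, Nat.nth_mem_of_infinite (infinite_isNew hinf) k,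
    Nat.count_nth_of_infinite (infinite_isNew hinf) k⟩

theorem chain_injective (hinf : (Set.range fun i => Quotient.mk η (e i)).Infinite) :
    Function.Injective (chain η e) := by
  have key : ∀ k l, k < l → chain η e k ≠ chain η e l := by
    intro k l hkl heq
    obtain ⟨j, hj, hjl⟩ := exists_rank_eq hinf l
    have h1 : e j ∈ chain η e l := hj.mem_chain_iff.2 hjl.le
    rw [← heq, hj.mem_chain_iff] at h1
    omega
  intro k l h
  rcases lt_trichotomy k l with h' | h' | h'
  · exact absurd h (key k l h')
  · exact h'
  · exact absurd h.symm (key l k h')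

/-- All indices of rank at most `k` lie below any index of rank `k + 1`. -/
theorem finite_classes_chain (hinf : (Set.range fun i => Quotient.mk η (e i)).Infinite) (k : ℕ) :
    (Quotient.mk η '' chain η e k).Finite := by
  obtain ⟨j, -, hjl⟩ := exists_rank_eq hinf (k + 1)
  refine ((Set.finite_Iio j).image fun i => Quotient.mk η (e i)).subset ?_
  rintro _ ⟨x, ⟨i, hi, hik⟩, rfl⟩
  refine ⟨i, ?_, Quotient.sound hi⟩
  by_contra hle
  have := rank_mono (η := η) (e := e) (not_lt.1 hle)
  omega

/-- The first index whose value is missing in `chain k` has rank `k + 1`. -/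
theorem exists_first_missing (hinf : (Set.range fun i => Quotient.mk η (e i)).Infinite) (k : ℕ) :
    ∃ z, rank η e z = k + 1 ∧ e z ∉ chain η e k ∧ ∀ i < z, e i ∈ chain η e k := by
  classical
  have hex : ∃ z, e z ∉ chain η e k := by
    obtain ⟨j, hj, hjk⟩ := exists_rank_eq hinf (k + 1)
    refine ⟨j, fun h => ?_⟩
    rw [hj.mem_chain_iff] at h
    omega
  have hmin : ∀ i < Nat.find hex, e i ∈ chain η e k := fun i hi => by
    simpa using Nat.find_min hex hi
  -- The rank grows only after a new index `i`; before the first gap such an `i` has its value in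
  -- `chain η e k`, hence rank at most `k`.
  have hle : ∀ i ≤ Nat.find hex, rank η e i ≤ k + 1 := by
    intro i hi
    induction i with
    | zero => exact (rank_le 0).trans (Nat.zero_le _)
    | succ i ih =>
      have h1 : rank η e (i + 1) = rank η e i + if IsNew η e i then 1 else 0 := Nat.count_succ _ i
      rw [h1]
      split_ifs with hnew
      · have := hnew.mem_chain_iff.1 (hmin i (by omega))
        omega
      · exact ih (by omega)
  refine ⟨Nat.find hex, le_antisymm (hle _ le_rfl) ?_, Nat.find_spec hex, hmin⟩
  by_contra hlt
  exact Nat.find_spec hex ⟨_, η.refl _, by omega⟩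

section Stages

variable (hE : IsStaged (fun p : ℕ × ℕ => η p.1 p.2) E)

include hE

/-- At stage `s` fewer equivalences are known, so more indices look new. -/
theorem rank_le_stageRank (s i : ℕ) : rank η e i ≤ stageRank E e s i := by
  classical
  exact Nat.count_mono_left fun j _ hj k hk hs => hj k hk (hE.sound hs)

theorem eventually_stageRank (i : ℕ) : ∀ᶠ s in atTop, stageRank E e s i = rank η e i := by
  classical
  have h1 : ∀ᶠ s in atTop, ∀ j ∈ Set.Iio i, ∀ k ∈ Set.Iio i,
      (E s (e k, e j) ↔ η (e k) (e j)) := by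
    refine ((Set.finite_Iio i).eventually_all).2 fun j _ => ?_
    exact ((Set.finite_Iio i).eventually_all).2 fun k _ => hE.eventually (e k, e j)
  filter_upwards [h1] with s hs
  have key : ∀ j < i, (StageNew E e s j ↔ IsNew η e j) := fun j hj => by
    unfold StageNew IsNew
    exact forall₂_congr fun k hk => not_congr (hs j hj k (hk.trans hj))
  exact le_antisymm (Nat.count_mono_left fun j hj h => (key j hj).1 h)
    (Nat.count_mono_left fun j hj h => (key j hj).2 h)

theorem primrec_stageRank (he : Primrec e) : Primrec₂ (stageRank E e) := by
  classical
  have h1 : PrimrecRel fun (i : ℕ) (q : ℕ × ℕ) => ¬ E q.1 (e i, e q.2) :=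
    (hE.prim.comp (((Primrec.fst.comp Primrec.snd)).pair ((he.comp Primrec.fst).pair
      (he.comp (Primrec.snd.comp Primrec.snd))))).not
  have h2 : PrimrecRel fun (n : ℕ) (q : ℕ × ℕ) => ∀ i < n, ¬ E q.1 (e i, e q.2) :=
    (h1.forall_mem_list.comp (Primrec.list_range.comp Primrec.fst) Primrec.snd).of_eq
      fun q => by simp
  have h3 : PrimrecPred fun q : ℕ × ℕ => StageNew E e q.1 q.2 := 
    h2.comp (f := fun q : ℕ × ℕ => q.2) (g := fun q : ℕ × ℕ => q) Primrec.snd Primrec.id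
  have h4 : Primrec fun q : ℕ × ℕ => Nat.rec (motive := fun _ => ℕ) 0
      (fun j c => c + if StageNew E e q.1 j then 1 else 0) q.2 := by
    refine Primrec.nat_rec' (α := ℕ × ℕ) (f := fun q => q.2) (g := fun _ => 0)
      (h := fun q p => p.2 + if StageNew E e q.1 p.1 then 1 else 0)
      Primrec.snd (Primrec.const 0) ?_
    change Primrec fun p : (ℕ × ℕ) × ℕ × ℕ => p.2.2 + if StageNew E e p.1.1 p.2.1 then 1 else 0
    refine Primrec.nat_add.comp (Primrec.snd.comp Primrec.snd) (Primrec.ite ?_ (Primrec.const 1)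
      (Primrec.const 0))
    exact h3.comp ((Primrec.fst.comp Primrec.fst).pair (Primrec.fst.comp Primrec.snd))
  refine h4.of_eq ?_
  rintro ⟨s, i⟩
  induction i with
  | zero => simp [stageRank]
  | succ i ih =>
    simp only [stageRank, Nat.count_succ] at ih ⊢
    rw [← ih]

/-- `rank η e i ≤ k` is an r.e. condition because `stageRank` approximates the rank from above. -/
theorem re_chain (hη : IsPositive η) (he : Primrec e) :
    REPred fun p : ℕ × ℕ => p.2 ∈ chain η e p.1 := by
  have h1 : REPred fun q : (ℕ × ℕ) × ℕ × ℕ => η (e q.2.1) q.1.2 ∧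
      stageRank E e q.2.2 q.2.1 ≤ q.1.1 := by
    refine re_and ?_ ?_
    · exact re_comp hη.re (f := fun q : (ℕ × ℕ) × ℕ × ℕ => (e q.2.1, q.1.2))
        ((he.comp (Primrec.fst.comp Primrec.snd)).pair
          (Primrec.snd.comp Primrec.fst)).to_comp
    · refine (PrimrecPred.computablePred ?_).to_re
      exact Primrec.nat_le.comp ((primrec_stageRank hE he).comp (Primrec.snd.comp Primrec.snd)
        (Primrec.fst.comp Primrec.snd)) (Primrec.fst.comp Primrec.fst)
  refine (re_exists (R := fun (p q : ℕ × ℕ) => η (e q.1) p.2 ∧ stageRank E e q.2 q.1 ≤ p.1)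
    h1).of_eq fun p => ?_
  constructor
  · rintro ⟨q, h2, h3⟩
    exact ⟨q.1, h2, (rank_le_stageRank hE _ _).trans h3⟩
  · rintro ⟨i, h2, h3⟩
    obtain ⟨s, hs⟩ := (eventually_stageRank hE (e := e) i).exists
    exact ⟨(i, s), h2, hs.le.trans h3⟩

theorem isFamily_chain (hη : IsPositive η) (he : Primrec e)
    (hinf : (Set.range fun i => Quotient.mk η (e i)).Infinite) : IsFamily η (chain η e) :=
  ⟨re_chain hE hη he, chain_injective hinf, etaClosed_chain⟩

omit hE in
theorem primrecRel_mem : PrimrecRel fun (σ : List (Option ℕ)) (x : ℕ) => some x ∈ σ := by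
  have h : PrimrecRel fun (a : Option ℕ) (x : ℕ) => a = some x :=
    Primrec.eq.comp Primrec.fst (Primrec.option_some.comp Primrec.snd)
  exact h.exists_mem_list.of_eq fun σ x => by simp

omit hE in
theorem computable_firstMissing (he : Primrec e) : Computable (firstMissing e) := by
  classical
  refine Computable.find (P := fun (σ : List (Option ℕ)) i => σ.length ≤ i ∨ some (e i) ∉ σ)
    ?_ _
  refine PrimrecPred.computablePred (PrimrecPred.or ?_ ?_)
  · exact Primrec.nat_le.comp (Primrec.list_length.comp Primrec.fst) Primrec.snd
  · exact (primrecRel_mem.comp Primrec.fst (he.comp Primrec.snd)).not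

theorem computable_chainGuess (he : Primrec e) : Computable (chainGuess E e) :=
  Primrec.nat_sub.to_comp.comp ((primrec_stageRank hE he).to_comp.comp Computable.list_length
    (computable_firstMissing he)) (Computable.const 1)

/-- Only the position `z` of the first gap matters, so this applies to contents outside the chain as
well. The subtraction of `1` reflects that the first gap of `chain η e k` has rank `k + 1`. -/
theorem eventually_chainGuess_of_first {T : Text} {z : ℕ} (hz : e z ∉ T.content)
    (hlt : ∀ i < z, e i ∈ T.content) :
    ∀ᶠ n in atTop, chainGuess E e (T.initial n) = rank η e z - 1 := by
  classical
  have h1 : ∀ᶠ n in atTop, firstMissing e (T.initial n) = z := by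
    refine eventually_find_eq (P := fun n i => (T.initial n).length ≤ i ∨ some (e i) ∉ T.initial n)
      _ ?_ ?_
    · filter_upwards [T.eventually_mem (e z)] with n hn
      exact Or.inr (hn.not.2 hz)
    · intro i hi
      filter_upwards [T.eventually_mem (e i), eventually_gt_atTop i] with n hn hni
      rintro (h | h)
      · rw [Text.length_initial] at h
        omega
      · exact h (hn.2 (hlt i hi))
  filter_upwards [h1, eventually_stageRank hE (e := e) z] with n hn hs
  rw [chainGuess, hn, Text.length_initial, hs]

/-- The text is constrained only on the values of `e`, so it may list a further class that `e` never
meets. -/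
theorem eventually_chainGuess (hinf : (Set.range fun i => Quotient.mk η (e i)).Infinite)
    {T : Text} {k : ℕ} (hT : ∀ i, e i ∈ T.content ↔ e i ∈ chain η e k) :
    ∀ᶠ n in atTop, chainGuess E e (T.initial n) = k := by
  obtain ⟨z, hz, hzk, hlt⟩ := exists_first_missing hinf k
  have := eventually_chainGuess_of_first hE (T := T) ((hT z).not.2 hzk)
    fun i hi => (hT i).2 (hlt i hi)
  simpa [hz] using this

end Stages

end Chain

/-! ### Combining families; explanatory learning when a proper infinite r.e. closed set exists. -/

section Families

variable {η : Setoid ℕ}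

/-- The family `L 0, H 0, L 1, H 1, …`. -/
def interleave (L H : ℕ → Set ℕ) (n : ℕ) : Set ℕ := if n % 2 = 0 then L (n / 2) else H (n / 2)

/-- The family `A, L 0, L 1, …`. -/
def consFamily (A : Set ℕ) (L : ℕ → Set ℕ) : ℕ → Set ℕ
  | 0 => A
  | n + 1 => L n

theorem interleave_even (L H : ℕ → Set ℕ) (n : ℕ) : interleave L H (2 * n) = L n := by
  simp [interleave]

theorem interleave_odd (L H : ℕ → Set ℕ) (n : ℕ) : interleave L H (2 * n + 1) = H n := by
  have h1 : (2 * n + 1) % 2 = 1 := by omega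
  have h2 : (2 * n + 1) / 2 = n := by omega
  simp [interleave, h1, h2]

theorem range_consFamily (A : Set ℕ) (L : ℕ → Set ℕ) :
    Set.range (consFamily A L) = insert A (Set.range L) := by
  ext B
  constructor
  · rintro ⟨_ | n, rfl⟩
    · exact Or.inl rfl
    · exact Or.inr ⟨n, rfl⟩
  · rintro (rfl | ⟨n, rfl⟩)
    · exact ⟨0, rfl⟩
    · exact ⟨n + 1, rfl⟩

theorem isFamily_consFamily {A : Set ℕ} {L : ℕ → Set ℕ} (hA : REPred fun x => x ∈ A)
    (hAc : EtaClosed η A) (hL : IsFamily η L) (hne : ∀ n, L n ≠ A) :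
    IsFamily η (consFamily A L) := by
  refine ⟨?_, ?_, ?_⟩
  · have h1 : REPred fun p : ℕ × ℕ => (p.1 = 0 ∧ p.2 ∈ A) ∨ (0 < p.1 ∧ p.2 ∈ L (p.1 - 1)) := by
      refine re_or (re_and (PrimrecPred.computablePred ?_).to_re (re_comp hA Computable.snd))
        (re_and (PrimrecPred.computablePred ?_).to_re ?_)
      · exact Primrec.eq.comp Primrec.fst (Primrec.const 0)
      · exact Primrec.nat_lt.comp (Primrec.const 0) Primrec.fst
      · exact re_comp hL.re (f := fun p : ℕ × ℕ => (p.1 - 1, p.2))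
          ((Primrec.pred.comp Primrec.fst).pair Primrec.snd).to_comp
    refine h1.of_eq ?_
    rintro ⟨_ | n, x⟩ <;> simp [consFamily]
  · rintro (_ | n) (_ | m) h
    · rfl
    · exact absurd h.symm (hne m)
    · exact absurd h (hne n)
    · exact congrArg _ (hL.injective h)
  · rintro (_ | n)
    · exact hAc
    · exact hL.closed n

theorem isStrongUnion_interleave {L H : ℕ → Set ℕ} (hL : IsFamily η L) (hH : IsFamily η H)
    (hne : ∀ i j, L i ≠ H j) : IsStrongUnion η L H (interleave L H) := by
  have hcases : ∀ n, ∃ m, n = 2 * m ∨ n = 2 * m + 1 := fun n => ⟨n / 2, by omega⟩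
  refine ⟨⟨?_, ?_, ?_⟩, ?_, ?_, ?_⟩
  · have hdiv : Computable fun p : ℕ × ℕ => (p.1 / 2, p.2) :=
      ((Primrec.nat_div.comp Primrec.fst (Primrec.const 2)).pair Primrec.snd).to_comp
    have hmod : PrimrecPred fun p : ℕ × ℕ => p.1 % 2 = 0 :=
      Primrec.eq.comp (Primrec.nat_mod.comp Primrec.fst (Primrec.const 2)) (Primrec.const 0)
    refine (re_or (re_and hmod.computablePred.to_re (re_comp hL.re hdiv))
      (re_and hmod.not.computablePred.to_re (re_comp hH.re hdiv))).of_eq ?_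
    rintro ⟨n, x⟩
    by_cases h : n % 2 = 0 <;> simp [interleave, h]
  · intro n m h
    obtain ⟨i, rfl | rfl⟩ := hcases n <;> obtain ⟨j, rfl | rfl⟩ := hcases m <;>
      simp only [interleave_even, interleave_odd] at h
    · rw [hL.injective h]
    · exact absurd h (hne _ _)
    · exact absurd h.symm (hne _ _)
    · rw [hH.injective h]
  · intro n
    obtain ⟨i, rfl | rfl⟩ := hcases n
    · rw [interleave_even]; exact hL.closed i
    · rw [interleave_odd]; exact hH.closed i
  · ext A
    constructor
    · rintro ⟨n, rfl⟩
      obtain ⟨i, rfl | rfl⟩ := hcases n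
      · rw [interleave_even]; exact Or.inl ⟨i, rfl⟩
      · rw [interleave_odd]; exact Or.inr ⟨i, rfl⟩
    · rintro (⟨i, rfl⟩ | ⟨i, rfl⟩)
      · exact ⟨2 * i, interleave_even L H i⟩
      · exact ⟨2 * i + 1, interleave_odd L H i⟩
  · exact ⟨fun i => 2 * i, Primrec.nat_double.to_comp, fun i j h => by simpa using h,
      fun i => (interleave_even L H i).symm⟩
  · exact ⟨fun i => 2 * i + 1, Primrec.nat_double_succ.to_comp, fun i j h => by simpa using h,
      fun i => (interleave_odd L H i).symm⟩

/-- For disjoint families `interleave` is a strong union. Refuting learnability over every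
hypothesis space `K` makes the interleaved indexing irrelevant. -/
theorem not_stronglyClosed_of_disjoint {I : Criterion} {L H : ℕ → Set ℕ} (hL : IsFamily η L)
    (hH : IsFamily η H) (hne : ∀ i j, L i ≠ H j) (lL : ExactlyLearnable I L)
    (lH : ExactlyLearnable I H)
    (hno : ∀ M K, Computable M → ¬ I M K (Set.range L ∪ Set.range H)) :
    ¬ StronglyClosedUnderUnion I η := by
  intro h
  have hU := isStrongUnion_interleave hL hH hne
  obtain ⟨M, hM, hI⟩ := h L H _ hL hH lL lH hU
  rw [hU.union] at hI
  exact hno M _ hM hI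

theorem re_class (hη : IsPositive η) (a : ℕ) : REPred fun x => η a x :=
  re_comp hη.re (f := fun x : ℕ => (a, x)) ((Computable.const a).pair Computable.id)

theorem exists_primrec_enum {U : Set ℕ} (hU : REPred fun x => x ∈ U) (hne : U.Nonempty) :
    ∃ e : ℕ → ℕ, Primrec e ∧ Set.range e = U := by
  classical
  obtain ⟨D, hD⟩ := exists_staged hU
  obtain ⟨x₀, hx₀⟩ := hne
  -- `n` codes a stage and a candidate; unconfirmed candidates are replaced by the known element
  -- `x₀`.
  refine ⟨fun n => if D n.unpair.1 n.unpair.2 then n.unpair.2 else x₀, ?_, ?_⟩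
  · have h2 : PrimrecPred fun n : ℕ => D n.unpair.1 n.unpair.2 := hD.prim.comp Primrec.unpair
    exact Primrec.ite h2 (Primrec.snd.comp Primrec.unpair) (Primrec.const x₀)
  · ext x
    constructor
    · rintro ⟨n, rfl⟩
      dsimp only
      split_ifs with h
      · exact hD.sound h
      · exact hx₀
    · intro hx
      obtain ⟨s, hs⟩ := (hD.iff x).1 hx
      exact ⟨Nat.pair s x, by simp [hs]⟩

/-- If some proper r.e. `η`-closed set meets infinitely many classes, explanatory learning is not
strongly closed under union. -/
theorem not_stronglyClosed_ex_of_proper (hη : IsPositive η) {U : Set ℕ}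
    (hU : REPred fun x => x ∈ U) (hUc : EtaClosed η U) (hUi : (Quotient.mk η '' U).Infinite)
    {a : ℕ} (ha : a ∉ U) : ¬ StronglyClosedUnderUnion ExLearns η := by
  classical
  obtain ⟨e, he, heU⟩ := exists_primrec_enum hU (Set.image_nonempty.1 hUi.nonempty)
  obtain ⟨E, hE⟩ := exists_staged hη.re
  have hinf : (Set.range fun i => Quotient.mk η (e i)).Infinite := by
    rw [← heU, ← Set.range_comp] at hUi
    exact hUi
  have heU' : ∀ i, e i ∈ U := fun i => heU ▸ Set.mem_range_self i
  have hsub : ∀ k, chain η e k ⊆ U := chain_subset hUc heU'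
  have haU : ∀ {x}, x ∈ U → ¬ η a x := fun hx hax => ha (hUc _ _ (η.symm hax) hx)
  have hchain := isFamily_chain hE hη he hinf
  -- `A` will be the limit of the sets `L k`. It is placed in the other family, whose remaining
  -- members omit `a`.
  set A : Set ℕ := U ∪ {x | η a x} with hA
  have hAc : EtaClosed η A := by
    rintro x y hxy (hx | hx)
    · exact Or.inl (hUc x y hxy hx)
    · exact Or.inr (η.trans hx hxy)
  have hAr : REPred fun x => x ∈ A := re_or hU (re_class hη a)
  have haA : a ∈ A := Or.inr (η.refl a)
  set L : ℕ → Set ℕ := fun k => chain η e k ∪ {x | η a x} with hL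
  have hLU : ∀ k i, e i ∈ L k ↔ e i ∈ chain η e k := fun k i =>
    ⟨fun h => h.resolve_right (haU (heU' i)), Or.inl⟩
  have haL : ∀ k, a ∈ L k := fun k => Or.inr (η.refl a)
  have hLsub : ∀ k, L k ⊆ A := fun k => Set.union_subset_union_left _ (hsub k)
  have hLne : ∀ k, L k ≠ A := by
    intro k heq
    obtain ⟨z, -, hz, -⟩ := exists_first_missing hinf k
    exact hz ((hLU k z).1 (heq ▸ Or.inl (heU' z)))
  have hLfam : IsFamily η L := by
    refine ⟨?_, ?_, ?_⟩
    · exact re_or hchain.re (re_comp (re_class hη a) Computable.snd)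
    · intro k l hkl
      apply hchain.injective
      have : ∀ k, chain η e k = L k \ {x | η a x} := by
        intro k
        ext x
        constructor
        · exact fun h => ⟨Or.inl h, haU (hsub k h)⟩
        · exact fun h => h.1.resolve_right h.2
      rw [this k, this l, hkl]
    · rintro k x y hxy (hx | hx)
      · exact Or.inl (hchain.closed k x y hxy hx)
      · exact Or.inr (η.trans hx hxy)
  have hacn : ∀ k, a ∉ chain η e k := fun k h => ha (hsub k h)
  have hHfam : IsFamily η (consFamily A (chain η e)) :=
    isFamily_consFamily hAr hAc hchain fun n h => hacn n (h ▸ haA)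
  refine not_stronglyClosed_of_disjoint hLfam hHfam ?_ ?_ ?_ ?_
  · rintro i (_ | j) h
    · exact hLne i h
    · exact hacn j (show a ∈ consFamily A (chain η e) (j + 1) from h ▸ haL i)
  · refine ⟨fun σ => some (chainGuess E e σ),
      Computable.option_some.comp (computable_chainGuess hE he), exLearns_of_eventually ?_⟩
    rintro _ ⟨k, rfl⟩ T hT
    refine ⟨k, rfl, ?_⟩
    filter_upwards [eventually_chainGuess hE hinf (T := T) (k := k)
      fun i => by rw [hT]; exact hLU k i] with n hn
    rw [hn]
  -- In this family the appearance of `a` identifies `A`, which has index `0`.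
  · refine ⟨fun σ => some (if some a ∈ σ then 0 else chainGuess E e σ + 1), ?_,
      exLearns_of_eventually ?_⟩
    · refine Computable.option_some.comp (computable_ite ?_ (Computable.const 0)
        (Computable.succ.comp (computable_chainGuess hE he)))
      exact (primrecRel_mem.comp Primrec.id (Primrec.const a)).computablePred
    · rintro _ ⟨_ | k, rfl⟩ T hT
      · refine ⟨0, rfl, ?_⟩
        filter_upwards [T.eventually_mem a] with n hn
        rw [if_pos (hn.2 (hT ▸ haA))]
      · refine ⟨k + 1, rfl, ?_⟩
        filter_upwards [T.eventually_mem a, eventually_chainGuess hE hinf (T := T) (k := k)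
          fun i => by rw [hT]; rfl] with n hn hg
        rw [if_neg (hn.not.2 (by rw [hT]; exact hacn k)), hg]
  · intro M K _
    refine not_exLearns_of_limit (A := A) (Or.inr ⟨0, rfl⟩) fun σ hσ => ?_
    have hfin : ∀ l : List (Option ℕ), SeqIn l A → ∃ k, SeqIn l (L k) := by
      intro l
      induction l with
      | nil => exact fun _ => ⟨0, fun x hx => by cases hx⟩
      | cons o l ih =>
        intro h
        obtain ⟨k, hk⟩ := ih fun x hx => h x (List.mem_cons_of_mem _ hx)
        have hLmono : ∀ {k l}, k ≤ l → L k ⊆ L l := fun hkl =>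
          Set.union_subset_union_left _ (chain_mono hkl)
        cases o with
        | none =>
          refine ⟨k, fun x hx => hk x ?_⟩
          simpa using hx
        | some y =>
          obtain ⟨m, hm⟩ : ∃ m, y ∈ L m := by
            rcases h y (by simp) with hy | hy
            · rw [← heU] at hy
              obtain ⟨i, rfl⟩ := hy
              exact ⟨i, Or.inl (mem_chain_of_le le_rfl)⟩
            · exact ⟨0, Or.inr hy⟩
          refine ⟨max k m, fun x hx => ?_⟩
          rcases List.mem_cons.1 hx with hx | hx
          · cases hx
            exact hLmono (le_max_right _ _) hm
          · exact hLmono (le_max_left _ _) (hk x hx)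
    obtain ⟨k, hk⟩ := hfin σ hσ
    exact ⟨L k, Or.inl ⟨k, rfl⟩, hk, hLsub k, hLne k⟩

end Families

/-! ### Explanatory learning when no proper r.e. closed set meets infinitely many classes. -/

section Strange

variable (η : Setoid ℕ) (E : ℕ → ℕ × ℕ → Prop)

/-- `y` is among the first two classes or is not the least element of its class. -/
def Redundant (y : ℕ) : Prop := y ∈ chain η id 1 ∨ ∃ x < y, η x y

/-- The union of the classes of `0` and `y`. -/
def pairSet (y : ℕ) : Set ℕ := {x | η 0 x ∨ η y x}

/-- A one-one family containing all sets `pairSet η y` for `y` outside the first two classes;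
the superfluous indices are diverted to members of the chain. -/
def pairFamily (y : ℕ) : Set ℕ :=
  {x | x ∈ pairSet η y ∨ (Redundant η y ∧ x ∈ chain η id (2 * y + 3))}

/-- The least element of `σ` that does not look equivalent to `0`. -/
noncomputable def pairGuess (σ : List (Option ℕ)) : ℕ :=
  open Classical in Nat.find
    (p := fun w => σ.length ≤ w ∨ (some w ∈ σ ∧ ¬ E σ.length (0, w))) ⟨σ.length, Or.inl le_rfl⟩

variable {η E}

theorem etaClosed_pairSet (y : ℕ) : EtaClosed η (pairSet η y) := by
  rintro x z hxz (hx | hx)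
  · exact Or.inl (η.trans hx hxz)
  · exact Or.inr (η.trans hx hxz)

theorem pairSet_congr {x y : ℕ} (h : η x y) : pairSet η x = pairSet η y := by
  ext z
  exact or_congr_right ⟨fun h' => η.trans (η.symm h) h', fun h' => η.trans h h'⟩

theorem chain_id_zero : chain η id 0 = {x | η 0 x} := by
  classical
  have h0 : IsNew η id 0 := fun i hi => absurd hi (Nat.not_lt_zero i)
  ext x
  constructor
  · rintro ⟨i, hi, hir⟩
    obtain ⟨j, hji, hj, hj'⟩ := exists_isNew (η := η) (e := id) i
    have hj0 : rank η id j = 0 := Nat.le_zero.1 ((rank_mono hji).trans hir)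
    have : j = 0 := Nat.count_injective (p := IsNew η id) hj h0
      (hj0.trans (Nat.le_zero.1 (rank_le (η := η) (e := id) 0)).symm)
    subst this
    exact η.trans hj' hi
  · intro hx
    exact ⟨0, hx, rank_le 0⟩

theorem pairFamily_of_not_redundant {y : ℕ} (h : ¬ Redundant η y) :
    pairFamily η y = pairSet η y := by
  ext x
  simp [pairFamily, h]

theorem pairFamily_of_redundant {y : ℕ} (h : Redundant η y) :
    pairFamily η y = chain η id (2 * y + 3) := by
  have h0 : (0 : ℕ) ∈ chain η id (2 * y + 3) := mem_chain_of_le (e := id) (Nat.zero_le _)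
  have hy : y ∈ chain η id (2 * y + 3) := mem_chain_of_le (e := id) (by omega)
  ext x
  constructor
  · rintro ((hx | hx) | hx)
    · exact etaClosed_chain _ _ _ hx h0
    · exact etaClosed_chain _ _ _ hx hy
    · exact hx.2
  · exact fun hx => Or.inr ⟨h, hx⟩

theorem infinite_range_mk (hη : IsPositive η) :
    (Set.range fun i => Quotient.mk η (id i)).Infinite := by
  have := hη.infinite
  have : (Set.range fun i => Quotient.mk η (id i)) = Set.univ :=
    Set.range_eq_univ.2 Quotient.mk_surjective
  rw [this]
  exact Set.infinite_univ

/-- `z` is the least number outside the class of `0`. It represents the second class, which a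
non-redundant `y` avoids; so all these pair sets have their first gap at `z`. -/
theorem exists_missing_pairSet (hη : IsPositive η) :
    ∃ z, rank η id z = 1 ∧ ∀ y, ¬ Redundant η y →
      z ∉ pairSet η y ∧ ∀ i < z, i ∈ pairSet η y := by
  obtain ⟨z, hz1, hz, hlt⟩ := exists_first_missing (infinite_range_mk hη) 0
  rw [chain_id_zero] at hz hlt
  refine ⟨z, hz1, fun y hy => ⟨?_, fun i hi => Or.inl (hlt i hi)⟩⟩
  rintro (h | h)
  · exact hz h
  · refine hy (Or.inl ⟨z, η.symm h, hz1.le⟩)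

theorem re_redundant (hη : IsPositive η) (hchain : IsFamily η (chain η id)) :
    REPred (Redundant η) := by
  refine re_or (re_comp hchain.re (f := fun y : ℕ => (1, y))
    ((Computable.const 1).pair Computable.id)) (re_exists (R := fun y x => x < y ∧ η x y) ?_)
  exact re_and (Primrec.nat_lt.comp Primrec.snd Primrec.fst).computablePred.to_re
    (re_comp hη.re (f := fun q : ℕ × ℕ => (q.2, q.1)) (Computable.snd.pair Computable.fst))

theorem re_pairSet (hη : IsPositive η) : REPred fun p : ℕ × ℕ => p.2 ∈ pairSet η p.1 :=
  re_or (re_comp (re_class hη 0) Computable.snd) hη.re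

theorem isFamily_pairFamily (hη : IsPositive η) (hchain : IsFamily η (chain η id)) :
    IsFamily η (pairFamily η) := by
  refine ⟨?_, ?_, ?_⟩
  · refine re_or (re_pairSet hη) (re_and (re_comp (re_redundant hη hchain) Computable.fst) ?_)
    exact re_comp hchain.re (f := fun p : ℕ × ℕ => (2 * p.1 + 3, p.2))
      (Primrec.pair (Primrec.nat_add.comp (Primrec.nat_double.comp Primrec.fst) (Primrec.const 3))
        Primrec.snd).to_comp
  · obtain ⟨z, hz1, hz⟩ := exists_missing_pairSet hη
    have hzc : ∀ y, z ∈ chain η id (2 * y + 3) := fun y => ⟨z, η.refl z, by omega⟩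
    -- Equal pair sets force `y` and `y'` to be equivalent, since neither is equivalent to `0`; both
    -- are least in their class.
    have hle : ∀ y y', ¬ Redundant η y → ¬ Redundant η y' → pairSet η y = pairSet η y' →
        y' ≤ y := by
      intro y y' hy hy' h
      have h1 : y ∈ pairSet η y' := h ▸ Or.inr (η.refl y)
      rcases h1 with h1 | h1
      · exact absurd (Or.inl ⟨0, h1, (rank_le 0).trans (Nat.zero_le _)⟩) hy
      · by_contra hlt
        exact hy' (Or.inr ⟨y, not_le.1 hlt, η.symm h1⟩)
    intro y y' h
    by_cases hy : Redundant η y <;> by_cases hy' : Redundant η y'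
    · rw [pairFamily_of_redundant hy, pairFamily_of_redundant hy'] at h
      have := hchain.injective h
      omega
    · rw [pairFamily_of_redundant hy, pairFamily_of_not_redundant hy'] at h
      exact absurd (h ▸ hzc y) (hz y' hy').1
    · rw [pairFamily_of_not_redundant hy, pairFamily_of_redundant hy'] at h
      exact absurd (h ▸ hzc y') (hz y hy).1
    · rw [pairFamily_of_not_redundant hy, pairFamily_of_not_redundant hy'] at h
      exact le_antisymm (hle y' y hy' hy h.symm) (hle y y' hy hy' h)
  · intro y
    by_cases hy : Redundant η y
    · rw [pairFamily_of_redundant hy]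
      exact hchain.closed _
    · rw [pairFamily_of_not_redundant hy]
      exact etaClosed_pairSet y

/-- Diverted indices give odd levels of the chain. A genuine pair set exceeds level `0` by `y` and
misses the second class, which all higher levels contain. -/
theorem pairFamily_ne_chain (hη : IsPositive η) (hchain : IsFamily η (chain η id)) (y k : ℕ) :
    pairFamily η y ≠ chain η id (2 * k) := by
  intro h
  by_cases hy : Redundant η y
  · rw [pairFamily_of_redundant hy] at h
    have := hchain.injective h
    omega
  · rw [pairFamily_of_not_redundant hy] at h
    obtain ⟨z, hz1, hz⟩ := exists_missing_pairSet hη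
    rcases Nat.eq_zero_or_pos k with rfl | hk
    · have h1 : y ∈ chain η id 0 := h ▸ Or.inr (η.refl y)
      exact hy (Or.inl (chain_mono (Nat.zero_le 1) h1))
    · have h1 : z ∈ chain η id (2 * k) := ⟨z, η.refl z, by omega⟩
      exact (hz y hy).1 (h ▸ h1)

section Guess

variable (hE : IsStaged (fun p : ℕ × ℕ => η p.1 p.2) E)

include hE

theorem computable_pairGuess : Computable (pairGuess E) := by
  classical
  refine Computable.find (P := fun (σ : List (Option ℕ)) w => σ.length ≤ w ∨
    (some w ∈ σ ∧ ¬ E σ.length (0, w))) (PrimrecPred.computablePred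
      (PrimrecPred.or ?_ (PrimrecPred.and ?_ (PrimrecPred.not ?_)))) _
  · exact Primrec.nat_le.comp (Primrec.list_length.comp Primrec.fst) Primrec.snd
  · exact primrecRel_mem.comp Primrec.fst Primrec.snd
  · exact hE.prim.comp ((Primrec.list_length.comp Primrec.fst).pair
      ((Primrec.const 0).pair Primrec.snd))

/-- Elements of the class of `0` are eventually recognized as such, and a non-redundant `y` is the
least element of its class. -/
theorem eventually_pairGuess {T : Text} {y : ℕ} (hy : ¬ Redundant η y)
    (hT : T.content = pairSet η y) : ∀ᶠ n in atTop, pairGuess E (T.initial n) = y := by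
  classical
  refine eventually_find_eq (P := fun n w => (T.initial n).length ≤ w ∨
    (some w ∈ T.initial n ∧ ¬ E (T.initial n).length (0, w))) _ ?_ ?_
  · filter_upwards [T.eventually_mem y] with n hn
    refine Or.inr ⟨hn.2 (hT ▸ Or.inr (η.refl y)), fun h => hy (Or.inl ?_)⟩
    exact ⟨0, hE.sound h, (rank_le 0).trans (Nat.zero_le _)⟩
  · intro w hw
    filter_upwards [eventually_gt_atTop w, hE.eventually (0, w)] with n hn hs
    rw [Text.length_initial, hs]
    rintro (h | ⟨h1, h2⟩)
    · omega
    · have h3 := T.seqIn_initial n w h1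
      rw [hT] at h3
      rcases h3 with h3 | h3
      · exact h2 h3
      · exact hy (Or.inr ⟨w, hw, η.symm h3⟩)

/-- The chain guess tends to `0` on genuine pair sets and to `2 * y + 3` on diverted ones, so it
tells in the limit which kind of set is presented. -/
theorem exactlyLearnable_pairFamily (hη : IsPositive η) :
    ExactlyLearnable ExLearns (pairFamily η) := by
  classical
  have hg := computable_chainGuess hE Primrec.id
  refine ⟨fun σ => some (if chainGuess E id σ = 0 then pairGuess E σ
    else (chainGuess E id σ - 3) / 2), ?_, exLearns_of_eventually ?_⟩
  · refine Computable.option_some.comp (computable_ite ?_ (computable_pairGuess hE) ?_)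
    · exact computablePred_comp (p := fun n : ℕ => n = 0)
        (Primrec.eq.comp Primrec.id (Primrec.const 0)).computablePred hg
    · exact (Primrec.nat_div.comp (Primrec.nat_sub.comp Primrec.id (Primrec.const 3))
        (Primrec.const 2)).to_comp.comp hg
  · rintro _ ⟨y, rfl⟩ T hT
    refine ⟨y, rfl, ?_⟩
    by_cases hy : Redundant η y
    · rw [pairFamily_of_redundant hy] at hT
      filter_upwards [eventually_chainGuess hE (infinite_range_mk hη) (T := T) (k := 2 * y + 3)
        fun i => by rw [hT]] with n hn
      rw [hn, if_neg (by omega)]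
      congr 1
      omega
    · rw [pairFamily_of_not_redundant hy] at hT
      obtain ⟨z, hz1, hz⟩ := exists_missing_pairSet hη
      filter_upwards [eventually_pairGuess hE hy hT, eventually_chainGuess_of_first hE (e := id)
        (T := T) (z := z) (by rw [hT]; exact (hz y hy).1)
        (fun i hi => by rw [hT]; exact (hz y hy).2 i hi)] with n h1 h2
      rw [h2, hz1, if_pos rfl, h1]

theorem exactlyLearnable_evenChain (hη : IsPositive η) :
    ExactlyLearnable ExLearns fun k => chain η id (2 * k) := by
  refine ⟨fun σ => some (chainGuess E id σ / 2), ?_, exLearns_of_eventually ?_⟩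
  · exact Computable.option_some.comp ((Primrec.nat_div.comp Primrec.id
      (Primrec.const 2)).to_comp.comp (computable_chainGuess hE Primrec.id))
  · rintro _ ⟨k, rfl⟩ T hT
    refine ⟨k, rfl, ?_⟩
    filter_upwards [eventually_chainGuess hE (infinite_range_mk hη) (T := T) (k := 2 * k)
      fun i => by rw [hT]] with n hn
    rw [hn, Nat.mul_div_cancel_left k (by omega)]

end Guess

theorem re_seqIn_pairSet (hη : IsPositive η) :
    REPred fun q : ℕ × List (Option ℕ) => SeqIn q.2 (pairSet η q.1) := by
  have h1 : REPred fun q : Option ℕ × ℕ => q.1 = none ∨ q.1.getD 0 ∈ pairSet η q.2 := by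
    refine re_or (PrimrecPred.computablePred ?_).to_re ?_
    · exact Primrec.eq.comp Primrec.fst (Primrec.const none)
    · exact re_comp (re_pairSet hη) (f := fun q : Option ℕ × ℕ => (q.2, q.1.getD 0))
        (Primrec.snd.pair (Primrec.option_getD.comp Primrec.fst (Primrec.const 0))).to_comp
  refine (re_forall_mem_list (R := fun (x : ℕ) (o : Option ℕ) =>
    o = none ∨ o.getD 0 ∈ pairSet η x) h1).of_eq ?_
  rintro ⟨x, τ⟩
  constructor
  · intro h y hy
    simpa using h (some y) hy
  · rintro h (_ | y) hy
    · exact Or.inl rfl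
    · exact Or.inr (h y hy)

/-- If every r.e. `η`-closed set meeting infinitely many classes is the whole of `ℕ`, explanatory
learning is not strongly closed under union. -/
theorem not_stronglyClosed_ex_of_no_proper (hη : IsPositive η)
    (hno : ∀ U : Set ℕ, (REPred fun x => x ∈ U) → EtaClosed η U →
      (Quotient.mk η '' U).Infinite → U = Set.univ) : ¬ StronglyClosedUnderUnion ExLearns η := by
  classical
  obtain ⟨E, hE⟩ := exists_staged hη.re
  have hinf := infinite_range_mk hη
  have hchain := isFamily_chain hE hη Primrec.id hinf
  have heven : IsFamily η fun k => chain η id (2 * k) := by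
    refine ⟨re_comp hchain.re (f := fun p : ℕ × ℕ => (2 * p.1, p.2)) ?_, fun i j h => ?_,
      fun i => hchain.closed _⟩
    · exact ((Primrec.nat_double.comp Primrec.fst).pair Primrec.snd).to_comp
    · have := hchain.injective h
      omega
  have hne := pairFamily_ne_chain hη hchain
  refine not_stronglyClosed_of_disjoint (isFamily_pairFamily hη hchain) heven hne
    (exactlyLearnable_pairFamily hE hη) (exactlyLearnable_evenChain hE hη) ?_
  intro M K hM hex
  have hA : chain η id (2 * 0) ∈
      Set.range (pairFamily η) ∪ Set.range fun k => chain η id (2 * k) := Or.inr ⟨0, rfl⟩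
  obtain ⟨σ, hσ, hl⟩ := hex.exists_locked hA
  obtain ⟨i, hi, hKi⟩ := hex.correct_of_locked hA hσ hl
  have hA0 : chain η id (2 * 0) = {x | η 0 x} := chain_id_zero
  -- The points `x` for which `σ` fails to lock `M` on the pair set of `x`. As `σ` locks `M` on the
  -- class of `0`, the point `0` is not among them.
  set X : Set ℕ := {x | ∃ τ, SeqIn τ (pairSet η x) ∧ M (σ ++ τ) ≠ M σ} with hX
  have hXr : REPred fun x => x ∈ X := by
    refine re_exists (re_and (re_seqIn_pairSet hη) (ComputablePred.to_re ?_))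
    refine ComputablePred.not (computablePred_comp (p := fun o : Option ℕ => o = M σ)
      (Primrec.eq.comp Primrec.id (Primrec.const _)).computablePred ?_)
    exact hM.comp (Computable.list_append.comp (Computable.const σ) Computable.snd)
  have hXc : EtaClosed η X := by
    intro x y hxy hx
    rw [hX, Set.mem_ofPred_eq, ← pairSet_congr hxy]
    exact hx
  have h0 : 0 ∉ X := by
    rintro ⟨τ, h1, h2⟩
    refine h2 (hl τ ?_)
    rw [hA0]
    exact fun x hx => (h1 x hx).elim id id
  have hXfin : (Quotient.mk η '' X).Finite := by
    by_contra h
    exact h0 (hno X hXr hXc h ▸ Set.mem_univ 0)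
  have hexy : ∃ y, y ∉ X ∪ chain η id 1 := by
    by_contra hall
    push Not at hall
    have := hη.infinite
    refine Set.infinite_univ (α := Quotient η)
      ((hXfin.union (finite_classes_chain hinf 1)).subset ?_)
    rw [← Set.image_union, Set.eq_univ_of_forall hall, Set.image_univ,
      Set.range_eq_univ.2 Quotient.mk_surjective]
  obtain ⟨hyX, hy1⟩ := not_or.1 (Nat.find_spec hexy)
  have hymin := fun m => Nat.find_min (m := m) hexy
  generalize Nat.find hexy = y at hyX hy1 hymin
  -- `y` was chosen least outside a closed set, hence it is least in its class.
  have hy : ¬ Redundant η y := by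
    rintro (h | ⟨x, hxy, hx⟩)
    · exact hy1 h
    · rcases not_not.1 (hymin x hxy) with h | h
      · exact hyX (hXc x y hx h)
      · exact hy1 (hchain.closed 1 x y hx h)
  have hyK := pairFamily_of_not_redundant hy
  -- `σ` now locks `M` on two distinct sets with a single guess.
  obtain ⟨j, hj, hKj⟩ := hex.correct_of_locked (A := pairFamily η y) (σ := σ) (Or.inl ⟨y, rfl⟩)
    (by rw [hyK]; exact hσ.mono (by rw [hA0]; exact fun x hx => Or.inl hx)) fun τ hτ => by
      by_contra h
      exact hyX ⟨τ, hyK ▸ hτ, h⟩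
  rw [hi] at hj
  cases hj
  exact hne y 0 (hKj.symm.trans hKi)

theorem not_stronglyClosed_ex (hη : IsPositive η) : ¬ StronglyClosedUnderUnion ExLearns η := by
  by_cases hno : ∀ U : Set ℕ, (REPred fun x => x ∈ U) → EtaClosed η U →
      (Quotient.mk η '' U).Infinite → U = Set.univ
  · exact not_stronglyClosed_ex_of_no_proper hη hno
  · push Not at hno
    obtain ⟨U, hU, hUc, hUi, hne⟩ := hno
    obtain ⟨a, ha⟩ := (Set.ne_univ_iff_exists_notMem U).1 hne
    exact not_stronglyClosed_ex_of_proper hη hU hUc hUi ha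

end Strange

/-! ### Confident learning: deciding between two candidates in the limit. -/

section Confident

/-- Of two candidate indices `a`, `b`, the one whose set looks right at the least point where the
two sets look different. -/
noncomputable def selectIndex (D : ℕ → ℕ × ℕ → Prop) (a b : ℕ) (σ : List (Option ℕ)) : ℕ :=
  open Classical in
  if a = b ∨ (some (Nat.find (p := fun x => σ.length ≤ x ∨
    ¬ (D σ.length (a, x) ↔ D σ.length (b, x))) ⟨σ.length, Or.inl le_rfl⟩) ∈ σ ↔
      D σ.length (a, Nat.find (p := fun x => σ.length ≤ x ∨
    ¬ (D σ.length (a, x) ↔ D σ.length (b, x))) ⟨σ.length, Or.inl le_rfl⟩)) then a else b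

variable {K : ℕ → Set ℕ} {D : ℕ → ℕ × ℕ → Prop}

theorem primrecPred_iff {α : Type*} [Primcodable α] {p q : α → Prop} (hp : PrimrecPred p)
    (hq : PrimrecPred q) : PrimrecPred fun a => p a ↔ q a :=
  ((hp.and hq).or (hp.not.and hq.not)).of_eq fun a => by tauto

theorem computable_selectIndex (hD : IsStaged (fun p : ℕ × ℕ => p.2 ∈ K p.1) D) :
    Computable fun q : (ℕ × ℕ) × List (Option ℕ) => selectIndex D q.1.1 q.1.2 q.2 := by
  classical
  have hlen : Primrec fun q : ((ℕ × ℕ) × List (Option ℕ)) × ℕ => q.1.2.length :=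
    Primrec.list_length.comp (Primrec.snd.comp Primrec.fst)
  have ha : PrimrecPred fun q : ((ℕ × ℕ) × List (Option ℕ)) × ℕ =>
      D q.1.2.length (q.1.1.1, q.2) := hD.prim.comp (hlen.pair
    ((Primrec.fst.comp (Primrec.fst.comp Primrec.fst)).pair Primrec.snd))
  have hb : PrimrecPred fun q : ((ℕ × ℕ) × List (Option ℕ)) × ℕ =>
      D q.1.2.length (q.1.1.2, q.2) := hD.prim.comp (hlen.pair
    ((Primrec.snd.comp (Primrec.fst.comp Primrec.fst)).pair Primrec.snd))
  have hfind := Computable.find (α := (ℕ × ℕ) × List (Option ℕ)) (P := fun q x =>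
    q.2.length ≤ x ∨ ¬ (D q.2.length (q.1.1, x) ↔ D q.2.length (q.1.2, x)))
    (((Primrec.nat_le.comp hlen Primrec.snd).or (primrecPred_iff ha hb).not).computablePred)
    (fun q => ⟨_, Or.inl le_rfl⟩)
  refine computable_ite (computablePred_or ?_ ?_) (Computable.fst.comp Computable.fst)
    (Computable.snd.comp Computable.fst)
  · exact (Primrec.eq.comp (Primrec.fst.comp Primrec.fst)
      (Primrec.snd.comp Primrec.fst)).computablePred
  · refine computablePred_comp (p := fun q : ((ℕ × ℕ) × List (Option ℕ)) × ℕ =>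
      (some q.2 ∈ q.1.2 ↔ D q.1.2.length (q.1.1.1, q.2)))
      (PrimrecPred.computablePred ?_) (Computable.id.pair hfind)
    exact primrecPred_iff (primrecRel_mem.comp (Primrec.snd.comp Primrec.fst) Primrec.snd) ha

/-- Convergence holds on every text, as confidence demands: for `a ≠ b` injectivity supplies a least
true difference, at which the search settles, and membership of that one point stabilizes. -/
theorem eventually_selectIndex (hD : IsStaged (fun p : ℕ × ℕ => p.2 ∈ K p.1) D)
    (hK : Function.Injective K) (a b : ℕ) (T : Text) :
    ∃ v, (∀ᶠ n in atTop, selectIndex D a b (T.initial n) = v) ∧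
      (T.content = K a → v = a) ∧ (T.content = K b → v = b) := by
  classical
  by_cases hab : a = b
  · subst hab
    exact ⟨a, Eventually.of_forall fun n => by simp [selectIndex], fun _ => rfl, fun _ => rfl⟩
  have hex : ∃ x, ¬ (x ∈ K a ↔ x ∈ K b) := by
    by_contra h
    push Not at h
    exact hab (hK (Set.ext h))
  set x := Nat.find hex with hx
  have hxs : ¬ (x ∈ K a ↔ x ∈ K b) := Nat.find_spec hex
  have hdiff : ∀ y, ∀ᶠ n in atTop,
      ((D n (a, y) ↔ D n (b, y)) ↔ (y ∈ K a ↔ y ∈ K b)) := by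
    intro y
    filter_upwards [hD.eventually (a, y), hD.eventually (b, y)] with n h1 h2
    rw [h1, h2]
  have hfind := eventually_find_eq (P := fun n x => (T.initial n).length ≤ x ∨
    ¬ (D (T.initial n).length (a, x) ↔ D (T.initial n).length (b, x)))
    (fun n => ⟨_, Or.inl le_rfl⟩) (z := x)
    (by
      filter_upwards [hdiff x] with n hn
      rw [Text.length_initial, hn]
      exact Or.inr hxs)
    (by
      intro y hy
      filter_upwards [hdiff y, eventually_gt_atTop y] with n hn hny
      rw [Text.length_initial, hn, not_or, not_not, not_le]
      exact ⟨hny, not_not.1 (Nat.find_min hex hy)⟩)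
  refine ⟨if (x ∈ T.content ↔ x ∈ K a) then a else b, ?_, ?_, ?_⟩
  · filter_upwards [hfind, T.eventually_mem x, hD.eventually (a, x)] with n h1 h2 h3
    have h3' : D (T.initial n).length (a, x) ↔ x ∈ K a := by rw [Text.length_initial]; exact h3
    have h4 : (a = b ∨ (some x ∈ T.initial n ↔ D (T.initial n).length (a, x))) ↔
        (x ∈ T.content ↔ x ∈ K a) := by
      rw [h2, h3', or_iff_right hab]
    simp only [selectIndex]
    rw [h1]
    exact if_congr h4 rfl rfl
  · intro h
    rw [h, if_pos Iff.rfl]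
  · intro h
    rw [h, if_neg fun h' => hxs h'.symm]

/-- Confidence makes each learner converge even on texts for members of the other family, so both
limit outputs `v₁`, `v₂` exist; on texts for a member of `K` at least one is correct. -/
theorem stronglyClosed_conf (η : Setoid ℕ) : StronglyClosedUnderUnion ConfLearns η := by
  rintro L H K - - ⟨M₁, hM₁, hex₁, hc₁⟩ ⟨M₂, hM₂, hex₂, hc₂⟩ ⟨hK, hKU, ⟨f, hf, -, hfK⟩,
    ⟨g, hg, -, hgK⟩⟩
  obtain ⟨D, hD⟩ := exists_staged hK.re
  let F : Option ℕ → Option ℕ → List (Option ℕ) → Option ℕ := fun o₁ o₂ σ =>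
    Option.casesOn o₁ (o₂.map g) fun a => some (Option.casesOn o₂ (f a) fun b =>
      selectIndex D (f a) (g b) σ)
  have hconv : ∀ T : Text, ∃ v₁ v₂, ∀ᶠ n in atTop,
      M₁ (T.initial n) = v₁ ∧ M₂ (T.initial n) = v₂ := by
    intro T
    obtain ⟨n₁, h₁⟩ := hc₁ T
    obtain ⟨n₂, h₂⟩ := hc₂ T
    refine ⟨M₁ (T.initial n₁), M₂ (T.initial n₂), ?_⟩
    filter_upwards [eventually_ge_atTop n₁, eventually_ge_atTop n₂] with n hn₁ hn₂
    exact ⟨h₁ n hn₁, h₂ n hn₂⟩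
  have main : ∀ T : Text, ∃ v, (∀ᶠ n in atTop,
      F (M₁ (T.initial n)) (M₂ (T.initial n)) (T.initial n) = v) ∧
      (T.content ∈ Set.range K → ∃ e, v = some e ∧ K e = T.content) := by
    intro T
    obtain ⟨v₁, v₂, hv⟩ := hconv T
    have hcorrect : T.content ∈ Set.range K →
        (∃ e, v₁ = some e ∧ K (f e) = T.content) ∨ ∃ e, v₂ = some e ∧ K (g e) = T.content := by
      rw [hKU]
      rintro (hT | hT)
      · obtain ⟨e, he, hev⟩ := hex₁.eventually hT rfl
        obtain ⟨n, hn, hn'⟩ := (hv.and hev).exists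
        exact Or.inl ⟨e, hn.1.symm.trans hn', by rw [← hfK, he]⟩
      · obtain ⟨e, he, hev⟩ := hex₂.eventually hT rfl
        obtain ⟨n, hn, hn'⟩ := (hv.and hev).exists
        exact Or.inr ⟨e, hn.2.symm.trans hn', by rw [← hgK, he]⟩
    have hF : ∀ {v}, (∀ᶠ n in atTop, F v₁ v₂ (T.initial n) = v) → ∀ᶠ n in atTop,
        F (M₁ (T.initial n)) (M₂ (T.initial n)) (T.initial n) = v := fun h => by
      filter_upwards [h, hv] with n h1 h2
      rw [h2.1, h2.2, h1]
    rcases v₁ with _ | a <;> rcases v₂ with _ | b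
    · refine ⟨none, hF (Eventually.of_forall fun _ => rfl), fun hT => ?_⟩
      rcases hcorrect hT with ⟨e, he, -⟩ | ⟨e, he, -⟩ <;> cases he
    · refine ⟨some (g b), hF (Eventually.of_forall fun _ => rfl), fun hT => ?_⟩
      rcases hcorrect hT with ⟨e, he, he'⟩ | ⟨e, he, he'⟩ <;> cases he
      exact ⟨_, rfl, he'⟩
    · refine ⟨some (f a), hF (Eventually.of_forall fun _ => rfl), fun hT => ?_⟩
      rcases hcorrect hT with ⟨e, he, he'⟩ | ⟨e, he, he'⟩ <;> cases he
      exact ⟨_, rfl, he'⟩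
    · obtain ⟨v, hv, ha, hb⟩ := eventually_selectIndex hD hK.injective (f a) (g b) T
      refine ⟨some v, hF (hv.mono fun n hn => congrArg some hn), fun hT => ?_⟩
      rcases hcorrect hT with ⟨e, he, he'⟩ | ⟨e, he, he'⟩ <;> cases he
      · exact ⟨v, rfl, by rw [ha he'.symm, he']⟩
      · exact ⟨v, rfl, by rw [hb he'.symm, he']⟩
  refine ⟨fun σ => F (M₁ σ) (M₂ σ) σ, ?_, exLearns_of_eventually ?_, ?_⟩
  · refine Computable.option_casesOn hM₁ (Computable.option_map hM₂ (hg.comp Computable.snd)) ?_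
    refine Computable.option_some.comp ?_
    refine Computable.option_casesOn (hM₂.comp Computable.fst) (hf.comp Computable.snd) ?_
    exact (computable_selectIndex hD).comp
      (((hf.comp (Computable.snd.comp Computable.fst)).pair (hg.comp Computable.snd)).pair
        (Computable.fst.comp Computable.fst))
  · rintro A hA T rfl
    obtain ⟨v, hv, hT⟩ := main T
    obtain ⟨e, rfl, he⟩ := hT hA
    exact ⟨e, he, hv⟩
  · intro T
    obtain ⟨v, hv, -⟩ := main T
    obtain ⟨n, hn⟩ := eventually_atTop.1 hv
    exact ⟨n, fun j hj => (hn j hj).trans (hn n le_rfl).symm⟩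

end Confident

/-! ### Finite learning via characteristic samples. -/

section Finite

variable {η : Setoid ℕ}

/-- The `η`-closure of the content of a finite sequence. -/
def seqClosure (η : Setoid ℕ) (σ : List (Option ℕ)) : Set ℕ := etaClosure η {y | some y ∈ σ}

theorem seqIn_seqClosure (σ : List (Option ℕ)) : SeqIn σ (seqClosure η σ) :=
  fun x hx => ⟨x, hx, η.refl x⟩

theorem etaClosed_seqClosure (σ : List (Option ℕ)) : EtaClosed η (seqClosure η σ) :=
  fun _ _ hxy ⟨z, hz, hzx⟩ => ⟨z, hz, η.trans hzx hxy⟩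

theorem seqClosure_subset {σ : List (Option ℕ)} {A : Set ℕ} (h : SeqIn σ A)
    (hA : EtaClosed η A) : seqClosure η σ ⊆ A := fun _ ⟨y, hy, hyx⟩ => hA _ _ hyx (h y hy)

theorem finite_classes_seqClosure (σ : List (Option ℕ)) :
    (Quotient.mk η '' seqClosure η σ).Finite := by
  refine ((List.finite_toSet σ).image fun o => Quotient.mk η (o.getD 0)).subset ?_
  rintro _ ⟨x, ⟨y, hy, hyx⟩, rfl⟩
  exact ⟨some y, hy, Quotient.sound hyx⟩

theorem re_seqClosure (hη : IsPositive η) :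
    REPred fun p : List (Option ℕ) × ℕ => p.2 ∈ seqClosure η p.1 := by
  refine re_exists (R := fun (p : List (Option ℕ) × ℕ) y => some y ∈ p.1 ∧ η y p.2) ?_
  exact re_and (primrecRel_mem.comp (Primrec.fst.comp Primrec.fst)
    Primrec.snd).computablePred.to_re (re_comp hη.re
      (f := fun q : (List (Option ℕ) × ℕ) × ℕ => (q.2, q.1.2))
      (Computable.snd.pair (Computable.snd.comp Computable.fst)))

theorem Text.take_initial (T : Text) {m n : ℕ} (h : m ≤ n) :
    (T.initial n).take m = T.initial m := by
  obtain ⟨k, rfl⟩ := Nat.exists_eq_add_of_le h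
  rw [Text.initial_add]
  exact List.take_left' (by simp)

/-- The sequence seen by a finite learner at its first proper output characterizes the set. -/
theorem FinLearns.exists_characteristic {M : Learner} {W : ℕ → Set ℕ} {C : Set (Set ℕ)}
    (h : FinLearns M W C) {A : Set ℕ} (hA : A ∈ C) {T : Text} (hT : T.content = A) :
    ∃ n, M (T.initial n) ≠ none ∧ (∀ m < n, M (T.initial m) = none) ∧
      ∀ B ∈ C, SeqIn (T.initial n) B → B = A := by
  obtain ⟨n, e, he, hWe, hlt, -⟩ := h A hA T hT
  refine ⟨n, by simp [he], hlt, fun B hB hσ => ?_⟩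
  -- A text for `B` sharing the segment on which `M` commits itself: the first output is the same,
  -- so `B` and `A` get the same index.
  set T' := prependText (T.initial n) (canonText B) with hT'
  have hcont : T'.content = B := (content_prependText _ _ (by rwa [content_canonText])).trans
    (content_canonText B)
  have hn : T'.initial n = T.initial n := by
    have := initial_prependText (T.initial n) (canonText B) 0
    rw [Nat.add_zero, Text.length_initial, ← hT'] at this
    rw [this]
    simp [Text.initial]
  have hm : ∀ m ≤ n, T'.initial m = T.initial m := fun m hm => by
    rw [← T'.take_initial hm, hn, T.take_initial hm]
  obtain ⟨n', e', he', hWe', hlt', -⟩ := h B hB T' hcont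
  have hnn : n' = n := by
    rcases lt_trichotomy n' n with h1 | h1 | h1
    · rw [hm n' h1.le, hlt n' h1] at he'
      cases he'
    · exact h1
    · have := hlt' n h1
      rw [hn, he] at this
      cases this
  rw [hnn, hn, he] at he'
  cases he'
  exact hWe'.symm.trans hWe

/-- A finitely learnable family yields a computable sequence of finite characteristic samples. -/
theorem exists_samples {B : ℕ → Set ℕ} (hB : IsFamily η B) {W : ℕ → Set ℕ}
    (hl : Learnable FinLearns W (Set.range B)) :
    ∃ G : ℕ → List (Option ℕ), Computable G ∧
      ∀ i j, SeqIn (G i) (seqClosure η (G j)) → i = j := by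
  classical
  obtain ⟨M, hM, hfin⟩ := hl
  obtain ⟨D, hD⟩ := exists_staged hB.re
  let T : ℕ → Text := fun i n => if D n.unpair.1 (i, n.unpair.2) then some n.unpair.2 else none
  have hTc : ∀ i, (T i).content = B i := by
    intro i
    ext x
    constructor
    · rintro ⟨n, hn⟩
      dsimp only [T] at hn
      split_ifs at hn with h
      cases hn
      exact hD.sound h
    · intro hx
      obtain ⟨s, hs⟩ := (hD.iff (i, x)).1 hx
      exact ⟨Nat.pair s x, by simp [T, hs]⟩
  have hTp : Primrec₂ T := by
    have h1 : PrimrecPred fun p : ℕ × ℕ => D p.2.unpair.1 (p.1, p.2.unpair.2) :=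
      hD.prim.comp ((Primrec.fst.comp (Primrec.unpair.comp Primrec.snd)).pair
        (Primrec.fst.pair (Primrec.snd.comp (Primrec.unpair.comp Primrec.snd))))
    exact Primrec.ite h1 (Primrec.option_some.comp (Primrec.snd.comp
      (Primrec.unpair.comp Primrec.snd))) (Primrec.const none)
  have hTi : Primrec fun p : ℕ × ℕ => (T p.1).initial p.2 :=
    Primrec.list_map (Primrec.list_range.comp Primrec.snd)
      (hTp.comp (Primrec.fst.comp Primrec.fst) Primrec.snd)
  choose n hn hlt hchar using fun i => hfin.exists_characteristic ⟨i, rfl⟩ (hTc i)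
  have hex : ∀ i, ∃ m, M ((T i).initial m) ≠ none := fun i => ⟨n i, hn i⟩
  have hfind : ∀ i, Nat.find (hex i) = n i := fun i =>
    (Nat.find_eq_iff _).2 ⟨hn i, fun m hm => not_not.2 (hlt i m hm)⟩
  have hnc : Computable n := by
    refine (Computable.find (P := fun i m => M ((T i).initial m) ≠ none) ?_ hex).of_eq hfind
    exact ComputablePred.not (computablePred_comp (p := fun o : Option ℕ => o = none)
      (Primrec.eq.comp Primrec.id (Primrec.const none)).computablePred (hM.comp hTi.to_comp))
  refine ⟨fun i => (T i).initial (n i), hTi.to_comp.comp (Computable.id.pair hnc), ?_⟩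
  intro i j hij
  have hj : SeqIn ((T j).initial (n j)) (B j) := by
    have := (T j).seqIn_initial (n j)
    rwa [hTc] at this
  -- The closure of the sample of `B j` lies in `B j`, so a sample of `B i` inside it forces `B j =
  -- B i`.
  exact (hB.injective (hchar i (B j) ⟨j, rfl⟩
    (hij.mono (seqClosure_subset hj (hB.closed j))))).symm

theorem isFamily_of_samples (hη : IsPositive η) {G : ℕ → List (Option ℕ)} (hG : Computable G)
    (hchar : ∀ i j, SeqIn (G i) (seqClosure η (G j)) → i = j) :
    IsFamily η fun i => seqClosure η (G i) := by
  refine ⟨?_, fun i j h => hchar i j ?_, fun i => etaClosed_seqClosure _⟩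
  · exact re_comp (re_seqClosure hη) (f := fun p : ℕ × ℕ => (G p.1, p.2))
      ((hG.comp Computable.fst).pair Computable.snd)
  · exact (congrArg (SeqIn (G i)) h).mp (seqIn_seqClosure _)

/-- The learner waits until some sample has been seen completely. On a text for the closure of `G i`
this can only be `G i`, so no wrong guess is ever made. -/
theorem finLearnable_of_samples {G : ℕ → List (Option ℕ)} (hG : Computable G)
    (hchar : ∀ i j, SeqIn (G i) (seqClosure η (G j)) → i = j) :
    ExactlyLearnable FinLearns fun i => seqClosure η (G i) := by
  classical
  -- The added `none` lets pauses inside a sample count as seen.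
  let P : List (Option ℕ) → ℕ → Prop := fun σ i => ∀ o ∈ G i, o ∈ none :: σ
  have hPc : ComputablePred fun q : List (Option ℕ) × ℕ => P q.1 q.2 := by
    have h1 : PrimrecRel fun (o : Option ℕ) (τ : List (Option ℕ)) => o ∈ τ := by
      have h2 : PrimrecRel fun (τ : List (Option ℕ)) (o : Option ℕ) => ∃ a ∈ τ, a = o :=
        PrimrecRel.exists_mem_list Primrec.eq
      exact (h2.comp Primrec.snd Primrec.fst).of_eq fun q => by simp
    have h3 : PrimrecRel fun (l τ : List (Option ℕ)) => ∀ o ∈ l, o ∈ τ := h1.forall_mem_list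
    refine computablePred_comp (p := fun q : List (Option ℕ) × List (Option ℕ) =>
      ∀ o ∈ q.1, o ∈ q.2) (PrimrecPred.computablePred h3)
      (f := fun q : List (Option ℕ) × ℕ => (G q.2, none :: q.1)) ?_
    exact (hG.comp Computable.snd).pair
      (Computable.list_cons.comp (Computable.const none) Computable.fst)
  -- The length bound makes the search total; a value below the length is a genuine hit.
  have hex : ∀ σ : List (Option ℕ), ∃ i, σ.length ≤ i ∨ P σ i := fun σ => ⟨_, Or.inl le_rfl⟩
  have hfc : Computable fun σ => Nat.find (hex σ) :=
    Computable.find (P := fun (σ : List (Option ℕ)) i => σ.length ≤ i ∨ P σ i)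
    (computablePred_or (Primrec.nat_le.comp (Primrec.list_length.comp Primrec.fst)
      Primrec.snd).computablePred hPc) hex
  let N : Learner := fun σ =>
    if Nat.find (hex σ) < σ.length then some (Nat.find (hex σ)) else none
  refine ⟨N, computable_ite ?_ (Computable.option_some.comp hfc) (Computable.const none), ?_⟩
  · exact computablePred_comp (p := fun q : ℕ × ℕ => q.1 < q.2)
      (Primrec.nat_lt.comp Primrec.fst Primrec.snd).computablePred
      (hfc.pair Computable.list_length)
  rintro _ ⟨i, rfl⟩ T hT
  have hPi : ∀ n j, P (T.initial n) j → j = i := by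
    intro n j hj
    refine hchar j i fun x hx => ?_
    have := hj _ hx
    have hx' : x ∈ T.content := T.seqIn_initial n x (by simpa using this)
    rwa [hT] at hx'
  have hval : ∀ n, N (T.initial n) = if i < n ∧ P (T.initial n) i then some i else none := by
    intro n
    have hs := Nat.find_spec (hex (T.initial n))
    have h1 := fun h => Nat.find_min' (hex (T.initial n)) (m := i) (Or.inr h)
    dsimp only [N]
    generalize Nat.find (hex (T.initial n)) = m at hs h1 ⊢
    rw [Text.length_initial] at hs ⊢
    by_cases h : i < n ∧ P (T.initial n) i
    · have h1 := h1 h.2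
      rcases hs with hs | hs
      · omega
      · rw [if_pos h, hPi n _ hs, if_pos h.1]
    · rw [if_neg h, if_neg]
      intro hlt
      have h2 := hPi n _ (hs.resolve_left (not_le.2 hlt))
      rcases hs with hs | hs
      · omega
      · rw [h2] at hs hlt
        exact h ⟨hlt, hs⟩
  have hmono : ∀ n m, n ≤ m → i < n ∧ P (T.initial n) i → i < m ∧ P (T.initial m) i := by
    rintro n m hnm ⟨h1, h2⟩
    refine ⟨h1.trans_le hnm, fun o ho => ?_⟩
    rcases List.mem_cons.1 (h2 o ho) with h3 | h3
    · exact h3 ▸ List.mem_cons_self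
    · obtain ⟨k, hk, hk'⟩ := Text.mem_initial.1 h3
      exact List.mem_cons_of_mem _ (Text.mem_initial.2 ⟨k, hk.trans_le hnm, hk'⟩)
  have hev : ∃ n, i < n ∧ P (T.initial n) i := by
    have h1 : ∀ᶠ n in atTop, ∀ o ∈ {o | o ∈ G i}, o ∈ none :: T.initial n := by
      refine ((List.finite_toSet (G i)).eventually_all).2 ?_
      rintro (_ | x) hx
      · exact Eventually.of_forall fun n => List.mem_cons_self
      · filter_upwards [T.eventually_mem x] with n hn
        exact List.mem_cons_of_mem _ (hn.2 (hT ▸ seqIn_seqClosure _ x hx))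
    exact ((eventually_gt_atTop i).and h1).exists
  refine ⟨Nat.find hev, i, ?_, rfl, fun m hm => ?_, fun j hj => ?_⟩
  · rw [hval, if_pos (Nat.find_spec hev)]
  · rw [hval, if_neg (Nat.find_min hev hm)]
  · rw [hval, hval, if_pos (Nat.find_spec hev), if_pos (hmono _ _ hj (Nat.find_spec hev))]

/-- The closure of `σ` consists of finitely many classes, and distinct samples inside it generate
distinct sets of these classes. -/
theorem finite_seqIn_samples {G : ℕ → List (Option ℕ)}
    (hchar : ∀ i j, SeqIn (G i) (seqClosure η (G j)) → i = j) (σ : List (Option ℕ)) :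
    {j | SeqIn (G j) (seqClosure η σ)}.Finite := by
  refine Set.Finite.of_finite_image (f := fun j => Quotient.mk η '' seqClosure η (G j))
    ((finite_classes_seqClosure (η := η) σ).finite_subsets.subset ?_) ?_
  · rintro _ ⟨j, hj, rfl⟩
    exact Set.image_mono (seqClosure_subset hj (etaClosed_seqClosure σ))
  · intro i _ j _ hij
    refine hchar i j fun x hx => ?_
    have h1 : Quotient.mk η x ∈ Quotient.mk η '' seqClosure η (G i) :=
      ⟨x, seqIn_seqClosure _ x hx, rfl⟩
    have h2 : Quotient.mk η x ∈ Quotient.mk η '' seqClosure η (G j) :=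
      (congrArg (Quotient.mk η x ∈ ·) hij).mp h1
    obtain ⟨y, hy, hyx⟩ := h2
    exact etaClosed_seqClosure _ y x (Quotient.exact hyx) hy

theorem not_stronglyClosed_fin (hη : IsPositive η) {B : ℕ → Set ℕ} (hB : IsFamily η B)
    {W : ℕ → Set ℕ} (hl : Learnable FinLearns W (Set.range B)) :
    ¬ StronglyClosedUnderUnion FinLearns η := by
  classical
  obtain ⟨G, hG, hchar⟩ := exists_samples hB hl
  -- The closure of `F` properly contains that of `G 0`. Discarding the finitely many samples inside
  -- it leaves a tail, from index `c + 1` on, that remains characteristic alongside either set.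
  set F := G 0 ++ G 1 with hF
  obtain ⟨c, hc⟩ := (finite_seqIn_samples hchar F).bddAbove
  have hGF : ∀ n, ¬ SeqIn (G (n + (c + 1))) (seqClosure η F) := fun n h => by
    have := hc h
    omega
  have h0F : SeqIn (G 0) (seqClosure η F) :=
    fun x hx => seqIn_seqClosure F x (List.mem_append_left _ hx)
  have h1F : SeqIn (G 1) (seqClosure η F) :=
    fun x hx => seqIn_seqClosure F x (List.mem_append_right _ hx)
  let R : ℕ → Set ℕ := fun n => seqClosure η (G (n + (c + 1)))
  have hshift : Computable fun n => G (n + (c + 1)) :=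
    hG.comp (Primrec.nat_add.comp Primrec.id (Primrec.const (c + 1))).to_comp
  have key : ∀ τ : List (Option ℕ), (∀ n, ¬ SeqIn τ (R n)) →
      (∀ n, ¬ SeqIn (G (n + (c + 1))) (seqClosure η τ)) →
      IsFamily η (consFamily (seqClosure η τ) R) ∧
        ExactlyLearnable FinLearns (consFamily (seqClosure η τ) R) := by
    intro τ h1 h2
    let G' : ℕ → List (Option ℕ) := fun n => Nat.casesOn n τ fun m => G (m + (c + 1))
    have hG' : Computable G' := Computable.nat_casesOn Computable.id (Computable.const τ)
      (hshift.comp Computable.snd)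
    have heq : consFamily (seqClosure η τ) R = fun n => seqClosure η (G' n) := by
      funext n
      cases n <;> rfl
    have hchar' : ∀ i j, SeqIn (G' i) (seqClosure η (G' j)) → i = j := by
      rintro (_ | i) (_ | j) h
      · rfl
      · exact absurd h (h1 j)
      · exact absurd h (h2 i)
      · have := hchar _ _ h
        omega
    rw [heq]
    exact ⟨isFamily_of_samples hη hG' hchar', finLearnable_of_samples hG' hchar'⟩
  have h0R : ∀ n, ¬ SeqIn (G 0) (R n) := fun n h => by
    have := hchar _ _ h
    omega
  obtain ⟨hLf, hLl⟩ := key (G 0) h0R fun n h => by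
    have := hchar _ _ h
    omega
  obtain ⟨hHf, hHl⟩ := key F (fun n h => h0R n fun x hx => h x (List.mem_append_left _ hx)) hGF
  have hsub : seqClosure η (G 0) ⊆ seqClosure η F :=
    seqClosure_subset h0F (etaClosed_seqClosure _)
  have hne : seqClosure η F ≠ seqClosure η (G 0) := fun h => by
    have := hchar 1 0 (h ▸ h1F)
    omega
  have hKf : IsFamily η (consFamily (seqClosure η (G 0)) (consFamily (seqClosure η F) R)) := by
    refine isFamily_consFamily (re_comp (re_seqClosure hη) (f := fun x : ℕ => (G 0, x))
      ((Computable.const _).pair Computable.id)) (etaClosed_seqClosure _) hHf ?_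
    rintro (_ | n) h
    · exact hne h
    · exact absurd (hLf.injective (a₁ := n + 1) (a₂ := 0) h) (by omega)
  have hU : IsStrongUnion η (consFamily (seqClosure η (G 0)) R) (consFamily (seqClosure η F) R)
      (consFamily (seqClosure η (G 0)) (consFamily (seqClosure η F) R)) := by
    refine ⟨hKf, ?_, ⟨fun n => Nat.casesOn n 0 fun m => m + 2, ?_, ?_, ?_⟩,
      ⟨Nat.succ, Computable.succ, Nat.succ_injective, fun _ => rfl⟩⟩
    · simp only [range_consFamily]
      ext A
      simp only [Set.mem_insert_iff, Set.mem_union]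
      tauto
    · exact Computable.nat_casesOn Computable.id (Computable.const 0)
        (Primrec.nat_add.comp Primrec.snd (Primrec.const 2)).to_comp
    · rintro (_ | i) (_ | j) h
      · rfl
      · exact absurd h (by simp)
      · exact absurd h (by simp)
      · simpa using h
    · rintro (_ | n) <;> rfl
  intro hclosed
  obtain ⟨M, -, hfin⟩ := hclosed _ _ _ hLf hHf hLl hHl hU
  -- A characteristic segment for the closure of `G 0` also lies in the larger closure of `F`, which
  -- belongs to the same union.
  obtain ⟨n, -, -, hn⟩ := hfin.exists_characteristic ⟨0, rfl⟩ (content_canonText _)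
  refine hne (hn _ ⟨1, rfl⟩ (SeqIn.mono ?_ hsub))
  have := (canonText (seqClosure η (G 0))).seqIn_initial n
  rwa [content_canonText] at this

end Finite

end PosLearn

theorem theorem5p5 (η : Setoid ℕ) (hη : PosLearn.IsPositive η) :
    PosLearn.StronglyClosedUnderUnion PosLearn.ConfLearns η ∧
    ¬ PosLearn.StronglyClosedUnderUnion PosLearn.ExLearns η ∧
    ((∃ B : ℕ → Set ℕ, PosLearn.IsFamily η B ∧
        PosLearn.Learnable PosLearn.FinLearns (PosLearn.closedW η) (Set.range B)) →
      ¬ PosLearn.StronglyClosedUnderUnion PosLearn.FinLearns η) :=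
  ⟨PosLearn.stronglyClosed_conf η, PosLearn.not_stronglyClosed_ex hη,
    fun ⟨_, hB, hl⟩ => PosLearn.not_stronglyClosed_fin hη hB hl⟩
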